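/- Work on $\mathbb R^3$ with the Euclidean metric $\delta_{ij}$, Cartesian coordinates $x^i$, $r=|x|$, $D_i=\partial_i$, the totally antisymmetric symbol $\epsilon_{ijk}$ with $\epsilon_{123}=1$, the summation convention, and round brackets denoting symmetrisation with weight $\tfrac12$. All tensor fields are smooth on all of $\mathbb R^3$. For a symmetric traceless field $u_{ij}$ put $$P(u)_{m\ell}=\tfrac12\,\epsilon_m{}^{ij}\,\partial_i\Big(\Delta u_{j\ell}-2\,\partial_{(\ell}D^n u_{j)n}+\tfrac12\,\delta_{j\ell}\,D^nD^k u_{nk}\Big).$$ A symmetric tensor field $h_{ij}$ is called TT (transverse-traceless) if $\partial_i h^i{}_j=0=h^i{}_i$. 1. Let $h_{ij}$ be a symmetric TT tensor field on $\mathbb R^3$, and set $$\sigma_{ijk}(x)=\int_0^1\epsilon_{ij}{}^{\ell}\,h_{\ell k}(\lambda x)\,\lambda(1-\lambda)^2\,d\lambda,\qquad u_{j\ell}=2\,x^m x^n x_{(j}\sigma_{\ell)mn}+r^2\,x^m\sigma_{m(j\ell)}.$$ Then $u$ is symmetric and traceless, and $P(u)=h$. 2. Conversely, for every symmetric traceless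 tensor field $u_{ij}$, the field $P(u)$ is symmetric, transverse and traceless. 3. Let $h$ be a symmetric TT tensor field and $\sigma\in\mathbb R$ with $h_{ij}=O(r^\sigma)$ as $r\to\infty$. Then there is a symmetric traceless $u$ with $P(u)=h$ (in general different from the one in 1) such that, as $r\to\infty$, $u_{ij}=O(r^{\sigma+3})$ if $\sigma\notin\{-4,-3,-2\}$, and $u_{ij}=O(r^{\sigma+3}\ln r)$ if $\sigma\in\{-4,-3,-2\}$. 4. If a symmetric TT tensor field $h$ has compact support, then there is a compactly supported symmetric traceless $u$ with $P(u)=h$. -/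

import Mathlib

open scoped ContDiff

noncomputable section

namespace TTPotential

/-- Euclidean three-space, with its Euclidean norm `r = ‖x‖`. -/
abbrev E3 : Type := EuclideanSpace ℝ (Fin 3)

/-- Fields of covariant two-tensors on `ℝ³`, given by their Cartesian components:
`h x i j` is the component `h_{ij}` at the point `x`. Since the metric is Euclidean and the
coordinates Cartesian, the position of an index (up or down) does not matter. -/
abbrev TensorField : Type := E3 → Fin 3 → Fin 3 → ℝ

/-- The Cartesian partial derivative `∂_i f`. -/
def pd (i : Fin 3) (f : E3 → ℝ) (x : E3) : ℝ :=
  fderiv ℝ f x (EuclideanSpace.single i (1 : ℝ))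

/-- The Euclidean Laplacian `Δ f = ∑ₙ ∂_n ∂_n f`. -/
def lap (f : E3 → ℝ) (x : E3) : ℝ :=
  ∑ n, pd n (pd n f) x

/-- The totally antisymmetric symbol with `ε_{012} = 1` (indices in `{0, 1, 2}`). -/
def eps (i j k : Fin 3) : ℝ :=
  (((j : ℕ) : ℝ) - ((i : ℕ) : ℝ)) * (((k : ℕ) : ℝ) - ((i : ℕ) : ℝ)) *
    (((k : ℕ) : ℝ) - ((j : ℕ) : ℝ)) / 2

/-- The divergence on the second index, `D^n u_{jn}`. -/
def divSnd (u : TensorField) (j : Fin 3) (x : E3) : ℝ :=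
  ∑ n, pd n (fun y => u y j n) x

/-- The double divergence `D^n D^k u_{nk}`. -/
def divDiv (u : TensorField) (x : E3) : ℝ :=
  ∑ n, pd n (divSnd u n) x

/-- The expression
`Δ u_{jl} - 2 ∂_{(l} D^n u_{j)n} + (1/2) δ_{jl} D^n D^k u_{nk}`
(round brackets denote symmetrisation with weight `1/2`). -/
def innerOp (u : TensorField) (j l : Fin 3) (x : E3) : ℝ :=
  lap (fun y => u y j l) x - (pd l (divSnd u j) x + pd j (divSnd u l) x)
    + (1 / 2) * (if j = l then divDiv u x else 0)

/-- The third-order operator `P(u)_{ml} = (1/2) ε_m^{ij} ∂_i (innerOp u)_{jl}`. -/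
def P (u : TensorField) : TensorField := fun x m l =>
  (1 / 2) * ∑ i, ∑ j, eps m i j * pd i (innerOp u j l) x

/-- Smooth fields of symmetric traceless tensors on `ℝ³`. -/
structure IsSymTraceless (u : TensorField) : Prop where
  smooth : ContDiff ℝ ∞ u
  symm : ∀ x i j, u x i j = u x j i
  traceless : ∀ x, ∑ i, u x i i = 0

/-- Smooth fields of symmetric, transverse (`∂_i h^i_j = 0`) and traceless tensors on `ℝ³`. -/
structure IsTT (h : TensorField) : Prop extends IsSymTraceless h where
  transverse : ∀ x j, ∑ i, pd i (fun y => h y i j) x = 0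

/-- `σ_{ijk}(x) = ∫₀¹ ε_{ij}^l h_{lk}(t x) t (1 - t)² dt`. -/
def sigma (h : TensorField) (i j k : Fin 3) (x : E3) : ℝ :=
  ∫ t in (0 : ℝ)..1, (∑ l, eps i j l * h (t • x) l k) * (t * (1 - t) ^ 2)

/-- The explicit potential
`u_{jl} = 2 x^m x^n x_{(j} σ_{l)mn} + r² x^m σ_{m(jl)}`
(round brackets denote symmetrisation with weight `1/2`). -/
def explicitPotential (h : TensorField) : TensorField := fun x j l =>
  (∑ m, ∑ n, x m * x n * (x j * sigma h l m n x + x l * sigma h j m n x))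
    + ‖x‖ ^ 2 * ∑ m, x m * ((sigma h m j l x + sigma h m l j x) / 2)

end TTPotential

end

namespace TTPotential

/-! Up to a constant factor, `P` is the linearised Cotton–York operator: the row-wise curl of a
symmetric tensor S. Transversality is div curl = 0, and tracelessness is the symmetry of S. Symmetry
of the curl amounts to div S = grad tr S, which holds when u is traceless.

The converse rests on one polynomial identity (`aP_aCubic`, `P_cubicField`). Let A(X, h) be the
cubic expression in X = x - y that is linear in a TT tensor h, and let E = X · ∂. Then `P` of A
applied to the dilated tensor x ↦ h(y + t(x - y)) is, up to normalisation, (E+2)(E+3)(E+4)h at the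
dilated point. Since t^n (E + n + 1) f at the dilated point is the t-derivative of t^(n+1) f there,
each factor is undone by one integration by parts in t. For a weight t q(t) with q quadratic the
integrand has an explicit primitive (`hasDerivAt_primitive`). For q = (1 - t)² on [0, 1] only the
term with q'' survives at t = 1, and it gives h. With y = 0 this is the explicit potential.

For decaying h the weight t(1 - t)² is too large near t = 0. Subtracting t q(t) on all of (0, ∞),
where q is 1, 1 - 2t or 1 - 2t + t², improves it there to O(t²), O(t³) or 0. This does not change
`P` of the potential, because the primitive of the added part vanishes at t = 0 and at infinity
(`integral_Ioi_quad_mul_eq_zero`). For t ≥ 1 the integral needs decay of h along the rays from the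
base point, which fails at x = y. Therefore the base point y is averaged against a bump function.
The average at large t samples h at scale t, and derivatives falling on h are moved to the bump
function (`avg_pd`), so no decay of derivatives of h is assumed. The formula h_ij = ½ ∂_k∂_l (z_i
z_j h_kl), valid for TT tensors, makes these averages O(t^σ) down to σ > -5, beyond the exponent -3
at which ‖z‖^σ stops being integrable (`IsTT.exists_avg_le`).

The growth of the potential is then governed by r³ ∫₀¹ t^p (1 + tr)^σ dt. This is O(r^(σ+3)) if p +
σ > -1 and acquires a logarithm if p + σ = -1. With p = 1, 2, 3 on the successive ranges of σ, the
borderline cases are σ = -2, -3, -4. For the full q = (1 - t)² the weight vanishes on [0, 1], so for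
h of compact support and x far out only points outside the support are sampled. -/

theorem fin3_01 : (0 : Fin 3) + 1 = 1 := rfl
theorem fin3_02 : (0 : Fin 3) + 2 = 2 := rfl
theorem fin3_11 : (1 : Fin 3) + 1 = 2 := rfl
theorem fin3_12 : (1 : Fin 3) + 2 = 0 := rfl
theorem fin3_21 : (2 : Fin 3) + 1 = 0 := rfl
theorem fin3_22 : (2 : Fin 3) + 2 = 1 := rfl

/-! ### The cubic polynomial of the potential -/

section Cubic

variable {R : Type*} [CommRing R]

/-- Twice the cubic expression in the position vector `x` occurring in the explicit potential. -/
def aCubic (x : Fin 3 → R) (h : Fin 3 → Fin 3 → R) (j l : Fin 3) : R :=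
  2 * (x j * ∑ n, (x (l + 1) * h (l + 2) n - x (l + 2) * h (l + 1) n) * x n
    + x l * ∑ n, (x (j + 1) * h (j + 2) n - x (j + 2) * h (j + 1) n) * x n)
    - (∑ n, x n * x n) * ((x (j + 1) * h (j + 2) l - x (j + 2) * h (j + 1) l)
      + (x (l + 1) * h (l + 2) j - x (l + 2) * h (l + 1) j))

theorem aCubic_symm (x : Fin 3 → R) (h : Fin 3 → Fin 3 → R) (i j : Fin 3) :
    aCubic x h i j = aCubic x h j i := by
  simp only [aCubic]
  ring

theorem aCubic_traceless (x : Fin 3 → R) {h : Fin 3 → Fin 3 → R}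
    (hs : ∀ i j, h i j = h j i) : ∑ i, aCubic x h i i = 0 := by
  have h10 := hs 1 0
  have h20 := hs 2 0
  have h21 := hs 2 1
  simp only [aCubic, Fin.sum_univ_three, Fin.isValue, fin3_01, fin3_02, fin3_11, fin3_12, fin3_21,
    fin3_22, h10, h20, h21]
  ring

theorem sum_fin_add_one {M : Type*} [AddCommMonoid M] (f : Fin 3 → M) :
    ∑ n, f (n + 1) = ∑ n, f n :=
  Equiv.sum_comp (Equiv.addRight (1 : Fin 3)) f

/-- Only cross products and scalar products enter, and these respect a cyclic relabelling of the
axes. This reduces the nine components of `aP_aCubic` to two. -/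
theorem aCubic_cyclic (x : Fin 3 → R) (h : Fin 3 → Fin 3 → R) (j l : Fin 3) :
    aCubic (fun i => x (i + 1)) (fun i j => h (i + 1) (j + 1)) j l
      = aCubic x h (j + 1) (l + 1) := by
  simp only [aCubic, add_right_comm j 1 2, add_right_comm l 1 2]
  rw [sum_fin_add_one fun n => x n * x n,
    sum_fin_add_one fun n => (x (l + 1 + 1) * h (l + 2 + 1) n - x (l + 2 + 1) * h (l + 1 + 1) n)
      * x n,
    sum_fin_add_one fun n => (x (j + 1 + 1) * h (j + 2 + 1) n - x (j + 2 + 1) * h (j + 1 + 1) n)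
      * x n]

end Cubic

/-! ### The operator over a ring with three commuting derivations -/

section Algebra

variable {R : Type*} [CommRing R] [Algebra ℝ R] (d : Fin 3 → Derivation ℝ R R)

/-- Divergence on the second index, over a ring with three derivations. -/
def aDiv (u : Fin 3 → Fin 3 → R) (j : Fin 3) : R := ∑ n, d n (u j n)

/-- Twice the inner operator, over a ring with three derivations. -/
def aInner (u : Fin 3 → Fin 3 → R) (j l : Fin 3) : R :=
  2 * ∑ n, d n (d n (u j l)) - 2 * (d l (aDiv d u j) + d j (aDiv d u l))
    + if j = l then ∑ n, d n (aDiv d u n) else 0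

/-- The row-wise curl. -/
def aCurl (S : Fin 3 → Fin 3 → R) (m l : Fin 3) : R :=
  d (m + 1) (S (m + 2) l) - d (m + 2) (S (m + 1) l)

/-- Four times the operator `P`, over a ring with three derivations. -/
def aP (u : Fin 3 → Fin 3 → R) : Fin 3 → Fin 3 → R := aCurl d (aInner d u)

variable {d}

/-- Divergence of a curl: mixed derivatives cancel in pairs. -/
theorem aP_transverse (hd : ∀ i j f, d i (d j f) = d j (d i f)) (u : Fin 3 → Fin 3 → R)
    (l : Fin 3) : ∑ m, d m (aP d u m l) = 0 := by
  simp only [aP, aCurl, Fin.sum_univ_three, map_sub, Fin.isValue]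
  simp only [fin3_01, fin3_02, fin3_11, fin3_12, fin3_21, fin3_22]
  rw [hd 1 0, hd 2 0, hd 2 1]
  ring

theorem aInner_symm {u : Fin 3 → Fin 3 → R} (hs : ∀ i j, u i j = u j i) (i j : Fin 3) :
    aInner d u i j = aInner d u j i := by
  simp only [aInner, hs i j, eq_comm (a := i)]
  ring

/-- The trace contracts the antisymmetric symbol with the symmetric indices of the inner tensor. -/
theorem aP_traceless {u : Fin 3 → Fin 3 → R} (hs : ∀ i j, u i j = u j i) :
    ∑ m, aP d u m m = 0 := by
  simp only [aP, aCurl, Fin.sum_univ_three, Fin.isValue]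
  simp only [fin3_01, fin3_02, fin3_11, fin3_12, fin3_21, fin3_22]
  rw [aInner_symm hs 1 0, aInner_symm hs 2 0, aInner_symm hs 2 1]
  ring

/-- The antisymmetric part of a curl of S is dual to div S - grad tr S. For the inner tensor S, both
terms are the same multiple of the gradient of the double divergence of u once u is traceless. The
proof eliminates `u 2 2` and expands. -/
theorem aP_symm (hd : ∀ i j f, d i (d j f) = d j (d i f)) {u : Fin 3 → Fin 3 → R}
    (hs : ∀ i j, u i j = u j i) (ht : ∑ i, u i i = 0) (m l : Fin 3) :
    aP d u m l = aP d u l m := by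
  have h22 : u 2 2 = - u 0 0 - u 1 1 := by
    rw [Fin.sum_univ_three] at ht
    linear_combination ht
  have h10 := hs 1 0
  have h20 := hs 2 0
  have h21 := hs 2 1
  have d10 := hd 1 0
  have d20 := hd 2 0
  have d21 := hd 2 1
  -- The numeral in `aInner` is a ring element to which the Leibniz rule also applies.
  have d2 : ∀ i, d i 2 = 0 := fun i => (d i).map_natCast 2
  have key : ∀ i j : Fin 3, i < j → aP d u i j = aP d u j i := by
    intro i j hij
    fin_cases i <;> fin_cases j <;> simp only [Fin.reduceLT, Fin.isValue, Fin.mk_one, Fin.zero_eta,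
      Fin.reduceFinMk, lt_self_iff_false] at hij <;>
    simp only [aP, aCurl, aInner, aDiv, Fin.sum_univ_three, h22, d2, h10, h20, h21,
      fin3_01, fin3_02, fin3_11, fin3_12, fin3_21, fin3_22, d10, d20, d21, Derivation.leibniz,
      map_add, map_sub, map_neg, smul_eq_mul, mul_zero, add_zero, Fin.reduceEq, if_true, if_false,
      Fin.isValue, Fin.mk_one, Fin.zero_eta, Fin.reduceFinMk] <;> ring
  rcases lt_trichotomy m l with h | h | h
  · exact key m l h
  · rw [h]
  · exact (key l m h).symm

variable (d) in
/-- The Euler derivation `x · ∂`. -/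
def aEuler (x : Fin 3 → R) (f : R) : R := ∑ n, x n * d n f

variable (d) in
/-- Four times `(x · ∂ + 2) (x · ∂ + 3) (x · ∂ + 4)`. -/
def aShift (x : Fin 3 → R) (f : R) : R :=
  4 * (aEuler d x (aEuler d x (aEuler d x f + 4 * f) + 3 * (aEuler d x f + 4 * f))
    + 2 * (aEuler d x (aEuler d x f + 4 * f) + 3 * (aEuler d x f + 4 * f)))

-- After elimination of the trace and divergence constraints the remaining derivatives of h are
-- treated as independent, and the claim is a polynomial identity in them and in x.
set_option maxHeartbeats 4000000 in
theorem aP_aCubic_zero_zero (hd : ∀ i j f, d i (d j f) = d j (d i f)) {x : Fin 3 → R}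
    (hx : ∀ i j, d i (x j) = if i = j then 1 else 0) {h : Fin 3 → Fin 3 → R}
    (hs : ∀ i j, h i j = h j i) (ht : ∑ i, h i i = 0) (hdiv : ∀ j, ∑ i, d i (h i j) = 0) :
    aP d (aCubic x h) 0 0 = aShift d x (h 0 0) := by
  have h22 : h 2 2 = - h 0 0 - h 1 1 := by
    rw [Fin.sum_univ_three] at ht
    linear_combination ht
  have h10 := hs 1 0
  have h20 := hs 2 0
  have h21 := hs 2 1
  have d10 := hd 1 0
  have d20 := hd 2 0
  have d21 := hd 2 1
  have d2 : ∀ i, d i 2 = 0 := fun i => (d i).map_natCast 2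
  have d3 : ∀ i, d i 3 = 0 := fun i => (d i).map_natCast 3
  have d4 : ∀ i, d i 4 = 0 := fun i => (d i).map_natCast 4
  -- The commutation rules `d10`, `d20`, `d21` move the derivation of largest index innermost, next
  -- to h. Solving the divergence constraints for `d 2` of components thus lets them rewrite every
  -- higher derivative as well.
  have e0 : d 2 (h 0 2) = - d 0 (h 0 0) - d 1 (h 0 1) := by
    have := hdiv 0
    rw [Fin.sum_univ_three, h10, h20] at this
    linear_combination this
  have e1 : d 2 (h 1 2) = - d 0 (h 0 1) - d 1 (h 1 1) := by
    have := hdiv 1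
    rw [Fin.sum_univ_three, h21] at this
    linear_combination this
  have e2 : d 2 (h 1 1) = d 0 (h 0 2) + d 1 (h 1 2) - d 2 (h 0 0) := by
    have := hdiv 2
    rw [Fin.sum_univ_three, h22, map_sub, map_neg] at this
    linear_combination -this
  simp only [aP, aCurl, aInner, aDiv, aCubic, aShift, aEuler, d2, d3, d4, Fin.sum_univ_three, h22, h10, h20, h21, Fin.isValue,
    fin3_11, fin3_12, fin3_21, fin3_22, d10, d20, d21,
    Derivation.leibniz, hx, smul_eq_mul, map_add, map_sub, map_neg,
    e0, e1, e2,
    Fin.reduceEq, if_true, if_false, mul_zero, mul_one, add_zero, zero_add, map_zero, Derivation.map_one_eq_zero]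
  ring
set_option maxHeartbeats 4000000 in
theorem aP_aCubic_zero_one (hd : ∀ i j f, d i (d j f) = d j (d i f)) {x : Fin 3 → R}
    (hx : ∀ i j, d i (x j) = if i = j then 1 else 0) {h : Fin 3 → Fin 3 → R}
    (hs : ∀ i j, h i j = h j i) (ht : ∑ i, h i i = 0) (hdiv : ∀ j, ∑ i, d i (h i j) = 0) :
    aP d (aCubic x h) 0 1 = aShift d x (h 0 1) := by
  have h22 : h 2 2 = - h 0 0 - h 1 1 := by
    rw [Fin.sum_univ_three] at ht
    linear_combination ht
  have h10 := hs 1 0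
  have h20 := hs 2 0
  have h21 := hs 2 1
  have d10 := hd 1 0
  have d20 := hd 2 0
  have d21 := hd 2 1
  have d2 : ∀ i, d i 2 = 0 := fun i => (d i).map_natCast 2
  have d3 : ∀ i, d i 3 = 0 := fun i => (d i).map_natCast 3
  have d4 : ∀ i, d i 4 = 0 := fun i => (d i).map_natCast 4
  have e0 : d 2 (h 0 2) = - d 0 (h 0 0) - d 1 (h 0 1) := by
    have := hdiv 0
    rw [Fin.sum_univ_three, h10, h20] at this
    linear_combination this
  have e1 : d 2 (h 1 2) = - d 0 (h 0 1) - d 1 (h 1 1) := by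
    have := hdiv 1
    rw [Fin.sum_univ_three, h21] at this
    linear_combination this
  have e2 : d 2 (h 1 1) = d 0 (h 0 2) + d 1 (h 1 2) - d 2 (h 0 0) := by
    have := hdiv 2
    rw [Fin.sum_univ_three, h22, map_sub, map_neg] at this
    linear_combination -this
  simp only [aP, aCurl, aInner, aDiv, aCubic, aShift, aEuler, d2, d3, d4, Fin.sum_univ_three, h22, h10, h20, h21, Fin.isValue,
    fin3_11, fin3_12, fin3_21, fin3_22, d10, d20, d21,
    Derivation.leibniz, hx, smul_eq_mul, map_add, map_sub, map_neg,
    e0, e1, e2,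
    Fin.reduceEq, if_true, if_false, mul_zero, mul_one, add_zero, zero_add, map_zero, Derivation.map_one_eq_zero]
  ring
theorem aP_cyclic (u : Fin 3 → Fin 3 → R) (m l : Fin 3) :
    aP (fun i => d (i + 1)) (fun i j => u (i + 1) (j + 1)) m l = aP d u (m + 1) (l + 1) := by
  have h1 : ∀ j, aDiv (fun i => d (i + 1)) (fun i j => u (i + 1) (j + 1)) j
      = aDiv d u (j + 1) := fun j => sum_fin_add_one fun n => d n (u (j + 1) n)
  have h2 : ∀ j l, aInner (fun i => d (i + 1)) (fun i j => u (i + 1) (j + 1)) j l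
      = aInner d u (j + 1) (l + 1) := by
    intro j l
    simp only [aInner, h1, sum_fin_add_one fun n => d n (d n (u (j + 1) (l + 1))),
      sum_fin_add_one fun n => d n (aDiv d u n), add_left_inj]
  simp only [aP, aCurl, h2, add_right_comm m 1 2]

theorem aShift_cyclic (x : Fin 3 → R) (f : R) :
    aShift (fun i => d (i + 1)) (fun i => x (i + 1)) f = aShift d x f := by
  have h : ∀ f, aEuler (fun i => d (i + 1)) (fun i => x (i + 1)) f = aEuler d x f :=
    fun f => sum_fin_add_one fun n => x n * d n f
  simp only [aShift, h]

theorem aP_aCubic (hd : ∀ i j f, d i (d j f) = d j (d i f)) {x : Fin 3 → R}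
    (hx : ∀ i j, d i (x j) = if i = j then 1 else 0) {h : Fin 3 → Fin 3 → R}
    (hs : ∀ i j, h i j = h j i) (ht : ∑ i, h i i = 0) (hdiv : ∀ j, ∑ i, d i (h i j) = 0)
    (m l : Fin 3) :
    aP d (aCubic x h) m l = aShift d x (h m l) := by
  have hsymm := aP_symm hd (aCubic_symm x h) (aCubic_traceless x hs)
  -- The data `d`, `x`, `h` are quantified inside, because the component identity is applied to
  -- cyclically rotated data.
  have cyc : ∀ a b : Fin 3, (∀ (d : Fin 3 → Derivation ℝ R R)
      (_ : ∀ i j f, d i (d j f) = d j (d i f)) (x : Fin 3 → R)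
      (_ : ∀ i j, d i (x j) = if i = j then 1 else 0) (h : Fin 3 → Fin 3 → R)
      (_ : ∀ i j, h i j = h j i) (_ : ∑ i, h i i = 0) (_ : ∀ j, ∑ i, d i (h i j) = 0),
      aP d (aCubic x h) a b = aShift d x (h a b)) →
      ∀ (d : Fin 3 → Derivation ℝ R R)
      (_ : ∀ i j f, d i (d j f) = d j (d i f)) (x : Fin 3 → R)
      (_ : ∀ i j, d i (x j) = if i = j then 1 else 0) (h : Fin 3 → Fin 3 → R)
      (_ : ∀ i j, h i j = h j i) (_ : ∑ i, h i i = 0) (_ : ∀ j, ∑ i, d i (h i j) = 0),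
      aP d (aCubic x h) (a + 1) (b + 1) = aShift d x (h (a + 1) (b + 1)) := by
    intro a b H d hd x hx h hs ht hdiv
    have := H (fun i => d (i + 1)) (fun i j => hd _ _) (fun i => x (i + 1))
      (fun i j => by simp only [hx, add_left_inj]) (fun i j => h (i + 1) (j + 1))
      (fun i j => hs _ _) ((sum_fin_add_one fun n => h n n).trans ht)
      (fun j => (sum_fin_add_one fun n => d n (h n (j + 1))).trans (hdiv _))
    rw [aShift_cyclic, ← aP_cyclic] at *
    simpa only [aCubic_cyclic, funext fun i => funext fun j => aCubic_cyclic x h i j] using this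
  have c00 : ∀ d, _ := fun d hd x hx h hs ht hdiv =>
    aP_aCubic_zero_zero (R := R) (d := d) hd (x := x) hx (h := h) hs ht hdiv
  have c01 : ∀ d, _ := fun d hd x hx h hs ht hdiv =>
    aP_aCubic_zero_one (R := R) (d := d) hd (x := x) hx (h := h) hs ht hdiv
  -- Rotation yields the diagonal and (1,2), (2,0); the other three components follow from symmetry
  -- of both sides.
  have c11 := cyc 0 0 c00
  have c22 := cyc 1 1 c11
  have c12 := cyc 0 1 c01
  have c20 := cyc 1 2 c12
  fin_cases m <;> fin_cases l
  · exact c00 d hd x hx h hs ht hdiv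
  · exact c01 d hd x hx h hs ht hdiv
  · exact (hsymm 0 2).trans ((c20 d hd x hx h hs ht hdiv).trans (by rw [hs]; rfl))
  · exact (hsymm 1 0).trans ((c01 d hd x hx h hs ht hdiv).trans (by rw [hs]; rfl))
  · exact c11 d hd x hx h hs ht hdiv
  · exact c12 d hd x hx h hs ht hdiv
  · exact c20 d hd x hx h hs ht hdiv
  · exact (hsymm 2 1).trans ((c12 d hd x hx h hs ht hdiv).trans (by rw [hs]; rfl))
  · exact c22 d hd x hx h hs ht hdiv

end Algebra
end TTPotential

noncomputable section

namespace TTPotential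

/-! ### Partial derivatives of smooth functions -/

theorem contDiff_fderiv_apply {E : Type*} [NormedAddCommGroup E] [NormedSpace ℝ E] {f : E → ℝ}
    (hf : ContDiff ℝ ∞ f) (v : E) : ContDiff ℝ ∞ fun x => fderiv ℝ f x v :=
  (hf.fderiv_right (m := ∞) (by simp)).clm_apply contDiff_const

theorem contDiff_pd {f : E3 → ℝ} (hf : ContDiff ℝ ∞ f) (i : Fin 3) : ContDiff ℝ ∞ (pd i f) :=
  contDiff_fderiv_apply hf _

theorem differentiable_of_contDiff {E : Type*} [NormedAddCommGroup E] [NormedSpace ℝ E]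
    {f : E → ℝ} (hf : ContDiff ℝ ∞ f) : Differentiable ℝ f :=
  hf.differentiable (by simp)

theorem pd_add {f g : E3 → ℝ} (hf : ContDiff ℝ ∞ f) (hg : ContDiff ℝ ∞ g) (i : Fin 3) :
    pd i (f + g) = pd i f + pd i g := by
  ext x
  simp [pd, fderiv_add (differentiable_of_contDiff hf x) (differentiable_of_contDiff hg x)]

theorem pd_const_smul {f : E3 → ℝ} (hf : ContDiff ℝ ∞ f) (c : ℝ) (i : Fin 3) :
    pd i (c • f) = c • pd i f := by
  ext x
  simp [pd, fderiv_const_smul (differentiable_of_contDiff hf x)]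

theorem pd_mul {f g : E3 → ℝ} (hf : ContDiff ℝ ∞ f) (hg : ContDiff ℝ ∞ g) (i : Fin 3) :
    pd i (f * g) = f * pd i g + g * pd i f := by
  ext x
  simp [pd, fderiv_mul (differentiable_of_contDiff hf x) (differentiable_of_contDiff hg x)]

theorem pd_comm {f : E3 → ℝ} (hf : ContDiff ℝ ∞ f) (i j : Fin 3) :
    pd i (pd j f) = pd j (pd i f) := by
  have h : ∀ (a b : E3) (x : E3),
      fderiv ℝ (fun y => fderiv ℝ f y a) x b = fderiv ℝ (fderiv ℝ f) x b a := by
    intro a b x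
    have hd : DifferentiableAt ℝ (fderiv ℝ f) x :=
      (hf.fderiv_right (m := ∞) (by simp)).differentiable (by simp) x
    rw [fderiv_clm_apply hd (differentiableAt_const a)]
    simp
  ext x
  have hs : IsSymmSndFDerivAt ℝ f x := hf.contDiffAt.isSymmSndFDerivAt (by
    rw [minSmoothness_of_isRCLikeNormedField]
    exact WithTop.coe_le_coe.2 le_top)
  exact (h _ _ x).trans ((hs _ _).trans (h _ _ x).symm)

theorem pd_coord (i j : Fin 3) (c : ℝ) :
    pd i (fun x => x j - c) = fun _ => if i = j then 1 else 0 := by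
  ext x
  have : HasFDerivAt (fun x : E3 => x j - c) (EuclideanSpace.proj j : E3 →L[ℝ] ℝ) x :=
    (EuclideanSpace.proj j : E3 →L[ℝ] ℝ).hasFDerivAt.sub_const c
  simp [pd, this.fderiv, eq_comm]

theorem contDiff_coord (j : Fin 3) : ContDiff ℝ ∞ fun x : E3 => x j :=
  (EuclideanSpace.proj j : E3 →L[ℝ] ℝ).contDiff

theorem fderiv_apply_eq_sum_pd (f : E3 → ℝ) (x v : E3) :
    fderiv ℝ f x v = ∑ i, v i * pd i f x := by
  have hv : v = ∑ i, v i • EuclideanSpace.single i (1 : ℝ) := by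
    ext j
    simp [Fin.sum_univ_three]
    fin_cases j <;> simp
  conv_lhs => rw [hv]
  simp [pd]

/-! ### The ring of smooth functions -/

/-- The algebra of smooth functions on `ℝ³`. -/
def smoothAlg : Subalgebra ℝ (E3 → ℝ) where
  carrier := {f | ContDiff ℝ ∞ f}
  mul_mem' {f g} (hf : ContDiff ℝ ∞ f) (hg : ContDiff ℝ ∞ g) := show ContDiff ℝ ∞ _ from hf.mul hg
  add_mem' {f g} (hf : ContDiff ℝ ∞ f) (hg : ContDiff ℝ ∞ g) := show ContDiff ℝ ∞ _ from hf.add hg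
  algebraMap_mem' c := show ContDiff ℝ ∞ fun _ : E3 => c from contDiff_const

/-- The partial derivative as a derivation of the algebra of smooth functions. -/
def pdD (i : Fin 3) : Derivation ℝ smoothAlg smoothAlg :=
  Derivation.mk'
    { toFun := fun f => ⟨pd i f.1, contDiff_pd f.2 i⟩
      map_add' := fun f g => Subtype.ext (pd_add f.2 g.2 i)
      map_smul' := fun c f => Subtype.ext (pd_const_smul f.2 c i) }
    fun f g => Subtype.ext (pd_mul f.2 g.2 i)

theorem pdD_coe (i : Fin 3) (f : smoothAlg) : (pdD i f : E3 → ℝ) = pd i f := rfl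

theorem pdD_comm (i j : Fin 3) (f : smoothAlg) : pdD i (pdD j f) = pdD j (pdD i f) :=
  Subtype.ext (pd_comm f.2 i j)

/-- The components of a smooth tensor field as elements of the algebra of smooth functions. -/
def bundle (u : TensorField) (hu : ∀ i j, ContDiff ℝ ∞ fun x => u x i j) (i j : Fin 3) :
    smoothAlg :=
  ⟨fun x => u x i j, hu i j⟩

/-! ### Passage between tensor fields and the algebra of smooth functions -/

section Transfer

variable {u : TensorField}

theorem aDiv_bundle (hu : ∀ i j, ContDiff ℝ ∞ fun x => u x i j)
    (j : Fin 3) :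
    ((aDiv pdD (bundle u hu) j : smoothAlg) : E3 → ℝ) = divSnd u j := by
  ext x
  simp [aDiv, divSnd, pdD_coe, bundle, Fin.sum_univ_three]

theorem aInner_bundle (hu : ∀ i j, ContDiff ℝ ∞ fun x => u x i j)
    (j l : Fin 3) :
    ((aInner pdD (bundle u hu) j l : smoothAlg) : E3 → ℝ) = (2 : ℝ) • innerOp u j l := by
  ext x
  have h2 : ((2 : smoothAlg) : E3 → ℝ) = 2 := rfl
  by_cases h : j = l
  · simp [aInner, innerOp, pdD_coe, aDiv_bundle, h, Fin.sum_univ_three, lap, divDiv, bundle, h2]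
    ring
  · simp [aInner, innerOp, pdD_coe, aDiv_bundle, h, Fin.sum_univ_three, lap, bundle, h2]
    ring

theorem contDiff_innerOp (hu : ∀ i j, ContDiff ℝ ∞ fun x => u x i j)
    (j l : Fin 3) : ContDiff ℝ ∞ (innerOp u j l) := by
  have h : innerOp u j l = (1 / 2 : ℝ) • ((aInner pdD (bundle u hu) j l : smoothAlg) : E3 → ℝ) := by
    rw [aInner_bundle, smul_smul]
    norm_num
  rw [h]
  exact contDiff_const.smul (aInner pdD (bundle u hu) j l).2

theorem aP_bundle (hu : ∀ i j, ContDiff ℝ ∞ fun x => u x i j)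
    (m l : Fin 3) :
    ((aP pdD (bundle u hu) m l : smoothAlg) : E3 → ℝ) = fun x => 4 * P u x m l := by
  ext x
  have h : ∀ i j l x, pd i ((2 : ℝ) • innerOp u j l) x = 2 * pd i (innerOp u j l) x := by
    intro i j l x
    rw [pd_const_smul (contDiff_innerOp hu j l)]
    rfl
  fin_cases m <;>
  · simp [aP, aCurl, P, pdD_coe, aInner_bundle, h, Fin.sum_univ_three, eps, fin3_22]
    ring

theorem P_eq_aP (hu : ∀ i j, ContDiff ℝ ∞ fun x => u x i j)
    (x : E3) (m l : Fin 3) :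
    P u x m l = 1 / 4 * (aP pdD (bundle u hu) m l : smoothAlg).1 x := by
  rw [aP_bundle hu m l]
  ring

end Transfer

theorem IsSymTraceless.contDiff {u : TensorField} (hu : IsSymTraceless u) (i j : Fin 3) :
    ContDiff ℝ ∞ fun x => u x i j :=
  contDiff_pi.1 (contDiff_pi.1 hu.smooth i) j

/-- `P u` is TT for symmetric traceless `u`. -/
theorem IsSymTraceless.isTT_P {u : TensorField} (hu : IsSymTraceless u) : IsTT (P u) := by
  have hc := hu.contDiff
  have hs : ∀ i j, bundle u hc i j = bundle u hc j i :=
    fun i j => Subtype.ext (funext fun x => hu.symm x i j)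
  have ht : ∑ i, bundle u hc i i = 0 := Subtype.ext (funext fun x => by
    simpa [bundle, Fin.sum_univ_three] using hu.traceless x)
  have hP : ∀ m l, (fun x => P u x m l)
      = (1 / 4 : ℝ) • ((aP pdD (bundle u hc) m l : smoothAlg) : E3 → ℝ) :=
    fun m l => funext fun x => P_eq_aP hc x m l
  refine ⟨⟨?_, ?_, ?_⟩, ?_⟩
  · refine contDiff_pi.2 fun m => contDiff_pi.2 fun l => ?_
    rw [hP]
    exact contDiff_const.smul (aP pdD (bundle u hc) m l).2
  · intro x m l
    rw [P_eq_aP hc, P_eq_aP hc, aP_symm pdD_comm hs ht]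
  · intro x
    simp only [P_eq_aP hc, ← Finset.mul_sum]
    have := congrArg (fun f : smoothAlg => f.1 x) (aP_traceless (d := pdD) hs)
    simp only [Fin.sum_univ_three] at this ⊢
    exact mul_eq_zero_of_right _ this
  · intro x l
    have := congrArg (fun f : smoothAlg => f.1 x)
      (aP_transverse (d := pdD) pdD_comm (bundle u hc) l)
    simp only [hP, pd_const_smul (aP pdD (bundle u hc) _ l).2, Pi.smul_apply, smul_eq_mul,
      ← Finset.mul_sum]
    simp only [Fin.sum_univ_three] at this ⊢
    exact mul_eq_zero_of_right _ this

/-! ### Radial dilations about a base point -/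

/-- The point obtained from `x` by the dilation of factor `t` about `y`. -/
def dil (t : ℝ) (x y : E3) : E3 := y + t • (x - y)

/-- The operator `(x - y) · ∂ + c`. -/
def shift (y : E3) (c : ℝ) (f : E3 → ℝ) (x : E3) : ℝ :=
  ∑ n, (x n - y n) * pd n f x + c * f x

theorem contDiff_shift (y : E3) (c : ℝ) {f : E3 → ℝ} (hf : ContDiff ℝ ∞ f) :
    ContDiff ℝ ∞ (shift y c f) :=
  (ContDiff.sum fun n _ => ((contDiff_coord n).sub contDiff_const).mul (contDiff_pd hf n)).add
    (contDiff_const.mul hf)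

theorem pd_comp_dil {f : E3 → ℝ} (hf : ContDiff ℝ ∞ f) (t : ℝ) (y : E3) (i : Fin 3) (x : E3) :
    pd i (fun x => f (dil t x y)) x = t * pd i f (dil t x y) := by
  have h1 : HasFDerivAt (fun x => dil t x y) (t • ContinuousLinearMap.id ℝ E3) x :=
    (((hasFDerivAt_id x).sub_const y).const_smul t).const_add y
  have h2 := (differentiable_of_contDiff hf (dil t x y)).hasFDerivAt.comp x h1
  rw [pd, show (fun x => f (dil t x y)) = f ∘ fun x => dil t x y from rfl, h2.fderiv]
  simp [pd]

theorem contDiff_dil (t : ℝ) (y : E3) : ContDiff ℝ ∞ fun x => dil t x y := by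
  unfold dil
  fun_prop

theorem dil_sub_apply (t : ℝ) (x y : E3) (n : Fin 3) :
    (dil t x y) n - y n = t * (x n - y n) := by
  simp [dil]

/-- The Euler operator centred at y commutes with dilations about y. -/
theorem shift_comp_dil {f : E3 → ℝ} (hf : ContDiff ℝ ∞ f) (t : ℝ) (y : E3) (c : ℝ) (x : E3) :
    shift y c (fun x => f (dil t x y)) x = shift y c f (dil t x y) := by
  simp only [shift, pd_comp_dil hf, dil_sub_apply]
  congr 1
  exact Finset.sum_congr rfl fun n _ => by ring

/-- Along a ray from y, t d/dt acts as the Euler operator, and the power of t supplies the constant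
`n + 1`. This is what converts the three factors of `shift3` into t-derivatives. -/
theorem hasDerivAt_dil {f : E3 → ℝ} (hf : ContDiff ℝ ∞ f) (x y : E3) (n : ℕ) (t : ℝ) :
    HasDerivAt (fun t => t ^ (n + 1) * f (dil t x y))
      (t ^ n * shift y (n + 1) f (dil t x y)) t := by
  have h1 : HasDerivAt (fun t => dil t x y) (x - y) t := by
    simpa [dil] using ((hasDerivAt_id t).smul_const (x - y)).const_add y
  have h2 := (differentiable_of_contDiff hf (dil t x y)).hasFDerivAt.comp_hasDerivAt t h1
  refine ((hasDerivAt_pow (n + 1) t).mul h2).congr_deriv ?_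
  simp only [fderiv_apply_eq_sum_pd, shift, dil_sub_apply, Function.comp, PiLp.sub_apply,
    Fin.sum_univ_three, Nat.add_sub_cancel]
  push_cast
  ring

/-- The field `(x · ∂ + 2) (x · ∂ + 3) (x · ∂ + 4) f`, centred at `y`. -/
def shift3 (y : E3) (f : E3 → ℝ) : E3 → ℝ := shift y 2 (shift y 3 (shift y 4 f))

/-- The integrand of the potential, centred at `y`: a cubic polynomial in `x - y` times the
tensor field dilated about `y`. -/
def cubicField (h : TensorField) (t : ℝ) (y : E3) : TensorField := fun x j l =>
  1 / 2 * aCubic (fun i => x i - y i) (h (dil t x y)) j l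

theorem IsTT.comp_dil {h : TensorField} (hh : IsTT h) (t : ℝ) (y : E3) :
    IsTT fun x => h (dil t x y) where
  smooth := hh.smooth.comp (contDiff_dil t y)
  symm x := hh.symm _
  traceless x := hh.traceless _
  transverse x j := by
    simp only [pd_comp_dil (hh.contDiff _ j), ← Finset.mul_sum, hh.transverse, mul_zero]

theorem aCubic_apply (X : Fin 3 → smoothAlg) (H : Fin 3 → Fin 3 → smoothAlg) (j l : Fin 3)
    (x : E3) : (aCubic X H j l).1 x = aCubic (fun i => (X i).1 x) (fun i j => (H i j).1 x) j l := by
  let ev : smoothAlg →+* ℝ := (Pi.evalRingHom (fun _ : E3 => ℝ) x).comp smoothAlg.val.toRingHom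
  have hev : ∀ f : smoothAlg, f.1 x = ev f := fun f => rfl
  simp only [hev, aCubic, map_sub, map_mul, map_add, map_sum, map_ofNat]

theorem contDiff_cubicField {h : TensorField} (hh : ∀ i j, ContDiff ℝ ∞ fun x => h x i j)
    (t : ℝ) (y : E3) (j l : Fin 3) :
    ContDiff ℝ ∞ fun x => cubicField h t y x j l := by
  have hc : ∀ i j, ContDiff ℝ ∞ fun x => h (dil t x y) i j :=
    fun i j => (hh i j).comp (contDiff_dil t y)
  have hX : ∀ i, ContDiff ℝ ∞ fun x : E3 => x i - y i :=
    fun i => (contDiff_coord i).sub contDiff_const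
  refine contDiff_const.mul ?_
  have h := (aCubic (fun i => (⟨_, hX i⟩ : smoothAlg)) (bundle _ hc) j l).2
  rwa [funext (aCubic_apply (fun i => (⟨_, hX i⟩ : smoothAlg)) (bundle _ hc) j l)] at h

/-- The third-order operator applied to the integrand of the potential. -/
theorem P_cubicField {h : TensorField} (hh : IsTT h) (t : ℝ) (y x : E3) (m l : Fin 3) :
    P (cubicField h t y) x m l = 1 / 2 * shift3 y (fun x => h x m l) (dil t x y) := by
  have hk := hh.comp_dil t y
  have hc := hk.contDiff
  have hX : ∀ i, ContDiff ℝ ∞ fun x : E3 => x i - y i :=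
    fun i => (contDiff_coord i).sub contDiff_const
  set X : Fin 3 → smoothAlg := fun i => ⟨_, hX i⟩ with hXdef
  have hXd : ∀ i j, pdD i (X j) = if i = j then 1 else 0 := by
    intro i j
    refine Subtype.ext ((pd_coord i j (y j)).trans ?_)
    split_ifs <;> rfl
  have key := aP_aCubic (d := pdD) pdD_comm hXd (h := bundle _ hc)
    (fun i j => Subtype.ext (funext fun x => hk.symm x i j))
    (Subtype.ext (funext fun x => by
      simpa [bundle, Fin.sum_univ_three] using hk.traceless x))
    (fun j => Subtype.ext (funext fun x => by
      simpa [bundle, Fin.sum_univ_three, pdD_coe] using hk.transverse x j)) m l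
  have hcub := contDiff_cubicField hh.contDiff t y
  have hb : bundle (cubicField h t y) hcub = (1 / 2 : ℝ) • aCubic X (bundle _ hc) := by
    funext j l
    refine Subtype.ext (funext fun x => ?_)
    change _ = (1 / 2 : ℝ) * (aCubic X (bundle _ hc) j l).1 x
    rw [aCubic_apply]
    rfl
  have hlin : ∀ (U : Fin 3 → Fin 3 → smoothAlg), aP pdD ((1 / 2 : ℝ) • U) m l
      = (1 / 2 : ℝ) • aP pdD U m l := by
    intro U
    have hd : ∀ j, aDiv pdD ((1 / 2 : ℝ) • U) j = (1 / 2 : ℝ) • aDiv pdD U j := by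
      intro j
      simp only [aDiv, Pi.smul_apply, Derivation.map_smul, Finset.smul_sum]
    have hi : ∀ j l, aInner pdD ((1 / 2 : ℝ) • U) j l = (1 / 2 : ℝ) • aInner pdD U j l := by
      intro j l
      simp only [aInner, hd, Pi.smul_apply, Derivation.map_smul, ← Finset.smul_sum,
        smul_add, smul_sub, smul_ite, smul_zero, mul_smul_comm]
      rw [← smul_add, mul_smul_comm]
    simp only [aP, aCurl, hi, Derivation.map_smul, smul_sub]
  have hE : ∀ f : smoothAlg, ∀ c : ℝ, ∀ x, (aEuler pdD X f + algebraMap ℝ smoothAlg c * f).1 x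
      = shift y c f.1 x := by
    intro f c x
    simp only [aEuler, shift, Fin.sum_univ_three]
    rfl
  rw [P_eq_aP hcub, hb, hlin, key]
  have hf : ContDiff ℝ ∞ fun x => h x m l := hh.contDiff m l
  have e4 : (aEuler pdD X (bundle _ hc m l) + 4 * bundle _ hc m l).1
      = fun x => shift y 4 (fun x => h x m l) (dil t x y) := by
    funext x
    exact (hE _ 4 x).trans (shift_comp_dil hf t y 4 x)
  set F4 := aEuler pdD X (bundle _ hc m l) + 4 * bundle _ hc m l
  have e3 : (aEuler pdD X F4 + 3 * F4).1
      = fun x => shift y 3 (shift y 4 (fun x => h x m l)) (dil t x y) := by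
    funext x
    refine (hE _ 3 x).trans ?_
    rw [e4]
    exact shift_comp_dil (contDiff_shift y 4 hf) t y 3 x
  set F3 := aEuler pdD X F4 + 3 * F4
  have e2 : (aEuler pdD X F3 + 2 * F3).1 x
      = shift3 y (fun x => h x m l) (dil t x y) := by
    refine (hE _ 2 x).trans ?_
    rw [e3]
    exact shift_comp_dil (contDiff_shift y 3 (contDiff_shift y 4 hf)) t y 2 x
  -- The 1/4 normalises `aP`, the 1/2 normalises `aCubic`, and the 4 is part of `aShift`.
  change 1 / 4 * ((1 / 2 : ℝ) * (4 * (aEuler pdD X F3 + 2 * F3).1 x)) = _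
  rw [e2]
  ring

end TTPotential
end

noncomputable section

namespace TTPotential

open MeasureTheory Metric Set

/-! ### Smoothness of parametric integrals -/

section Parametric

variable {A E : Type*} [NormedAddCommGroup E] [NormedSpace ℝ E]

/-- A class of locally dominated families of smooth functions which is closed under directional
derivatives. -/
structure IsDominatedClass [MeasurableSpace A] (μ : Measure A) (S : Set (A → E → ℝ)) : Prop where
  smooth : ∀ Φ ∈ S, ∀ a, ContDiff ℝ ∞ (Φ a)
  deriv : ∀ Φ ∈ S, ∀ v, (fun a x => fderiv ℝ (Φ a) x v) ∈ S
  meas : ∀ Φ ∈ S, ∀ x, AEStronglyMeasurable (fun a => Φ a x) μ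
  bound : ∀ Φ ∈ S, ∀ x₀, ∃ ε > 0, ∃ b : A → ℝ, Integrable b μ ∧
    ∀ᵐ a ∂μ, ∀ x ∈ ball x₀ ε, |Φ a x| ≤ b a

theorem IsDominatedClass.integrable [MeasurableSpace A] {μ : Measure A} {S : Set (A → E → ℝ)}
    (hS : IsDominatedClass μ S) {Φ : A → E → ℝ} (hΦ : Φ ∈ S) (x : E) :
    Integrable (fun a => Φ a x) μ := by
  obtain ⟨ε, hε, b, hbi, hb⟩ := hS.bound Φ hΦ x
  refine hbi.mono' (hS.meas Φ hΦ x) ?_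
  filter_upwards [hb] with a ha using ha x (mem_ball_self hε)

/-- Sums of elements of two dominated classes form a dominated class. -/
theorem IsDominatedClass.add [MeasurableSpace A] {μ : Measure A} {S T : Set (A → E → ℝ)}
    (hS : IsDominatedClass μ S) (hT : IsDominatedClass μ T) :
    IsDominatedClass μ {Φ | ∃ Ψ ∈ S, ∃ Θ ∈ T, Φ = fun a x => Ψ a x + Θ a x} := by
  refine ⟨?_, ?_, ?_, ?_⟩
  · rintro _ ⟨Ψ, hΨ, Θ, hΘ, rfl⟩ a
    exact (hS.smooth Ψ hΨ a).add (hT.smooth Θ hΘ a)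
  · rintro _ ⟨Ψ, hΨ, Θ, hΘ, rfl⟩ v
    refine ⟨_, hS.deriv Ψ hΨ v, _, hT.deriv Θ hΘ v, funext fun a => funext fun x => ?_⟩
    rw [fderiv_fun_add (differentiable_of_contDiff (hS.smooth Ψ hΨ a) x)
      (differentiable_of_contDiff (hT.smooth Θ hΘ a) x)]
    rfl
  · rintro _ ⟨Ψ, hΨ, Θ, hΘ, rfl⟩ x
    exact (hS.meas Ψ hΨ x).add (hT.meas Θ hΘ x)
  · rintro _ ⟨Ψ, hΨ, Θ, hΘ, rfl⟩ x
    obtain ⟨ε, hε, b, hb, h1⟩ := hS.bound Ψ hΨ x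
    obtain ⟨δ, hδ, c, hc, h2⟩ := hT.bound Θ hΘ x
    refine ⟨min ε δ, lt_min hε hδ, _, hb.add hc, ?_⟩
    filter_upwards [h1, h2] with a ha1 ha2 y hy
    exact (abs_add_le _ _).trans (add_le_add
      (ha1 y (ball_subset_ball (min_le_left _ _) hy))
      (ha2 y (ball_subset_ball (min_le_right _ _) hy)))

variable [FiniteDimensional ℝ E]

/-- Differentiation under the integral sign. -/
theorem IsDominatedClass.hasFDerivAt_integral [MeasurableSpace A] {μ : Measure A}
    {S : Set (A → E → ℝ)}
    (hS : IsDominatedClass μ S)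
    {Φ : A → E → ℝ} (hΦ : Φ ∈ S) (x₀ : E) :
    Integrable (fun a => fderiv ℝ (Φ a) x₀) μ ∧
      HasFDerivAt (fun x => ∫ a, Φ a x ∂μ) (∫ a, fderiv ℝ (Φ a) x₀ ∂μ) x₀ := by
  -- Domination is known only for directional derivatives. In finite dimension those along a basis
  -- control the operator norm of the derivative, up to the constant `C`.
  let e := Module.finBasis ℝ E
  obtain ⟨C, hC, hCe⟩ := e.exists_opNorm_le (F := ℝ)
  choose ε hε b hbi hb using fun i => hS.bound _ (hS.deriv Φ hΦ (e i)) x₀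
  have hsum : ∀ L : E →L[ℝ] ℝ, L = ∑ i, L (e i) • (e.coord i).toContinuousLinearMap := by
    intro L
    refine ContinuousLinearMap.coe_injective (e.ext fun j => ?_)
    simp [Finsupp.single_apply]
  have hm : ∀ x, AEStronglyMeasurable (fun a => fderiv ℝ (Φ a) x) μ := by
    intro x
    rw [funext fun a => hsum (fderiv ℝ (Φ a) x)]
    exact Finset.aestronglyMeasurable_fun_sum _ fun i _ => (hS.meas _ (hS.deriv Φ hΦ (e i)) x).smul_const _
  have hs : (⋂ i, ball x₀ (ε i)) ∈ nhds x₀ :=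
    (Filter.iInter_mem).2 fun i => ball_mem_nhds x₀ (hε i)
  have hnn : ∀ᵐ a ∂μ, ∀ x ∈ ⋂ i, ball x₀ (ε i), ‖fderiv ℝ (Φ a) x‖ ≤ C * ∑ i, b i a := by
    have : ∀ᵐ a ∂μ, ∀ i, ∀ x ∈ ball x₀ (ε i), |fderiv ℝ (Φ a) x (e i)| ≤ b i a :=
      ae_all_iff.2 hb
    filter_upwards [this] with a ha x hx
    have hx' := mem_iInter.1 hx
    have hnb : ∀ i, 0 ≤ b i a := fun i => (abs_nonneg _).trans (ha i x (hx' i))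
    exact hCe (Finset.sum_nonneg fun i _ => hnb i) fun i => (ha i x (hx' i)).trans
      (Finset.single_le_sum (f := fun i => b i a) (fun i _ => hnb i) (Finset.mem_univ i))
  have hbI : Integrable (fun a => C * ∑ i, b i a) μ :=
    (integrable_finsetSum _ fun i _ => hbi i).const_mul C
  refine ⟨hbI.mono' (hm x₀) ?_, ?_⟩
  · filter_upwards [hnn] with a ha using ha x₀ (mem_of_mem_nhds hs)
  · refine hasFDerivAt_integral_of_dominated_of_fderiv_le hs
      (Filter.Eventually.of_forall fun x => hS.meas Φ hΦ x) (hS.integrable hΦ x₀) (hm x₀) hnn hbI ?_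
    exact Filter.Eventually.of_forall fun a x _ => (differentiable_of_contDiff (hS.smooth Φ hΦ a) x).hasFDerivAt

/-- A directional derivative of the integral is again an integral of a member of `S`, so
differentiability bootstraps by induction on the order. -/
theorem IsDominatedClass.contDiff_integral [MeasurableSpace A] {μ : Measure A}
    {S : Set (A → E → ℝ)}
    (hS : IsDominatedClass μ S)
    {Φ : A → E → ℝ} (hΦ : Φ ∈ S) :
    ContDiff ℝ ∞ (fun x => ∫ a, Φ a x ∂μ) ∧
      ∀ x v, fderiv ℝ (fun x => ∫ a, Φ a x ∂μ) x v = ∫ a, fderiv ℝ (Φ a) x v ∂μ := by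
  have key := fun {Φ : A → E → ℝ} (hΦ : Φ ∈ S) (x : E) =>
    hS.hasFDerivAt_integral hΦ x
  have hf : ∀ {Φ : A → E → ℝ}, Φ ∈ S → ∀ x v,
      fderiv ℝ (fun x => ∫ a, Φ a x ∂μ) x v = ∫ a, fderiv ℝ (Φ a) x v ∂μ := by
    intro Φ hΦ x v
    rw [(key hΦ x).2.fderiv, ContinuousLinearMap.integral_apply (key hΦ x).1]
  refine ⟨?_, hf hΦ⟩
  rw [contDiff_infty]
  intro n
  induction n generalizing Φ with
  | zero => exact contDiff_zero.2 (continuous_iff_continuousAt.2 fun x => (key hΦ x).2.continuousAt)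
  | succ n ih =>
    rw [Nat.cast_succ, contDiff_succ_iff_fderiv_apply]
    refine ⟨fun x => (key hΦ x).2.differentiableAt, by simp, fun v => ?_⟩
    simp only [hf hΦ]
    exact ih (hS.deriv Φ hΦ v)

end Parametric

/-! ### Dominated classes from compactly supported weights -/

section Weighted

variable {A E : Type*} [NormedAddCommGroup E] [NormedSpace ℝ E]
  [NormedAddCommGroup A] [NormedSpace ℝ A]

/-- The families `w a * F a x`, with `w` a fixed weight and `F` jointly smooth. -/
def weighted (E : Type*) [NormedAddCommGroup E] [NormedSpace ℝ E] (w : A → ℝ) :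
    Set (A → E → ℝ) :=
  {Φ | ∃ F : A → E → ℝ, ContDiff ℝ ∞ (fun p : A × E => F p.1 p.2) ∧ Φ = fun a x => w a * F a x}

theorem contDiff_partial_fderiv {F : A → E → ℝ} (hF : ContDiff ℝ ∞ fun p : A × E => F p.1 p.2)
    (v : E) : ContDiff ℝ ∞ fun p : A × E => fderiv ℝ (F p.1) p.2 v := by
  have := contDiff_fderiv_apply hF ((0, v) : A × E)
  convert this using 2 with p
  have h1 : HasFDerivAt (fun x => (p.1, x)) (ContinuousLinearMap.inr ℝ A E) p.2 :=
    hasFDerivAt_prodMk_right p.1 p.2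
  have h2 := (differentiable_of_contDiff hF (p.1, p.2)).hasFDerivAt.comp p.2 h1
  rw [show F p.1 = (fun p : A × E => F p.1 p.2) ∘ fun x => (p.1, x) from rfl, h2.fderiv]
  simp

theorem contDiff_section {F : A → E → ℝ} (hF : ContDiff ℝ ∞ fun p : A × E => F p.1 p.2) (a : A) :
    ContDiff ℝ ∞ (F a) :=
  hF.comp (contDiff_const.prodMk contDiff_id)

/-- Weights supported in a compact set give dominated classes. -/
theorem isDominatedClass_weighted [FiniteDimensional ℝ E] [MeasurableSpace A] [BorelSpace A]
    {μ : Measure A} {w : A → ℝ} (hw : Integrable w μ) {K : Set A} (hK : IsCompact K) (hwK : ∀ a ∉ K, w a = 0) :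
    IsDominatedClass μ (weighted E w) := by
  have hfd : ∀ {F : A → E → ℝ}, ContDiff ℝ ∞ (fun p : A × E => F p.1 p.2) → ∀ a x v,
      fderiv ℝ (fun x => w a * F a x) x v = w a * fderiv ℝ (F a) x v := by
    intro F hF a x v
    rw [fderiv_const_mul (differentiable_of_contDiff (contDiff_section hF a) x)]
    simp
  refine ⟨?_, ?_, ?_, ?_⟩
  · rintro _ ⟨F, hF, rfl⟩ a
    exact contDiff_const.mul (contDiff_section hF a)
  · rintro _ ⟨F, hF, rfl⟩ v
    exact ⟨_, contDiff_partial_fderiv hF v, funext fun a => funext fun x => hfd hF a x v⟩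
  · rintro _ ⟨F, hF, rfl⟩ x
    exact hw.aestronglyMeasurable.mul
      (hF.continuous.comp (Continuous.prodMk_left x)).aestronglyMeasurable
  · rintro _ ⟨F, hF, rfl⟩ x₀
    obtain ⟨M, hM⟩ := (hK.prod (isCompact_closedBall x₀ 1)).bddAbove_image
      hF.continuous.norm.continuousOn
    refine ⟨1, one_pos, fun a => |w a| * M, hw.abs.mul_const M, .of_forall fun a x hx => ?_⟩
    by_cases ha : a ∈ K
    · rw [abs_mul]
      exact mul_le_mul_of_nonneg_left
        (hM (mem_image_of_mem _ (mk_mem_prod ha (ball_subset_closedBall hx)))) (abs_nonneg _)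
    · simp [hwK a ha]

end Weighted

/-! ### The operator `P` under an integral sign -/

/-- The index set of the third derivatives of the components of a tensor field. -/
abbrev JetIndex : Type := Fin 3 × Fin 3 × Fin 3 × Fin 3 × Fin 3

/-- The third derivatives of the components of a tensor field. -/
def thirdJet (u : TensorField) (x : E3) (p : JetIndex) : ℝ :=
  pd p.1 (pd p.2.1 (pd p.2.2.1 fun y => u y p.2.2.2.1 p.2.2.2.2)) x

/-- The linear form through which `P` acts on third derivatives. -/
def jetForm (m l : Fin 3) : (JetIndex → ℝ) →ₗ[ℝ] ℝ :=
  let T (i j : Fin 3) : (JetIndex → ℝ) →ₗ[ℝ] ℝ :=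
    (2 : ℝ) • ∑ n, LinearMap.proj (i, n, n, j, l)
      - (2 : ℝ) • (∑ n, LinearMap.proj (i, l, n, j, n) + ∑ n, LinearMap.proj (i, j, n, l, n))
      + if j = l then ∑ n, ∑ k, LinearMap.proj (i, n, k, n, k) else 0
  (1 / 4 : ℝ) • (T (m + 1) (m + 2) - T (m + 2) (m + 1))

/-- `P` is a fixed finite linear combination of third derivatives, so interchanging it with an
integral reduces to interchanging each of these. -/
theorem P_eq_jetForm {u : TensorField} (hu : ∀ i j, ContDiff ℝ ∞ fun x => u x i j) (x : E3)
    (m l : Fin 3) : P u x m l = jetForm m l (thirdJet u x) := by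
  have d2 : ∀ i, pdD i 2 = 0 := fun i => (pdD i).map_natCast 2
  have h2 : ((2 : smoothAlg) : E3 → ℝ) = 2 := rfl
  rw [P_eq_aP hu]
  simp only [aP, aCurl, aInner, aDiv, jetForm, LinearMap.smul_apply, LinearMap.sub_apply,
    LinearMap.add_apply, LinearMap.sum_apply, LinearMap.proj_apply, thirdJet, map_add, map_sub,
    Derivation.leibniz, d2, smul_eq_mul, map_sum]
  by_cases h1 : m + 1 = l <;> by_cases h3 : m + 2 = l <;>
  simp [h1, h3, Fin.sum_univ_three, pdD_coe, bundle, h2, thirdJet]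

theorem IsDominatedClass.integrable_thirdJet {A : Type*} [MeasurableSpace A] {μ : Measure A}
    {S : Set (A → E3 → ℝ)} (hS : IsDominatedClass μ S) {Φ : A → TensorField}
    (hΦ : ∀ i j, (fun a x => Φ a x i j) ∈ S) (x : E3) (p : JetIndex) :
    Integrable (fun a => thirdJet (Φ a) x p) μ :=
  hS.integrable (hS.deriv _ (hS.deriv _ (hS.deriv _ (hΦ p.2.2.2.1 p.2.2.2.2) _) _) _) x

theorem IsDominatedClass.integrable_P {A : Type*} [MeasurableSpace A] {μ : Measure A}
    {S : Set (A → E3 → ℝ)} (hS : IsDominatedClass μ S) {Φ : A → TensorField}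
    (hΦ : ∀ i j, (fun a x => Φ a x i j) ∈ S) (x : E3) (m l : Fin 3) :
    Integrable (fun a => P (Φ a) x m l) μ := by
  simp only [P_eq_jetForm fun i j => hS.smooth _ (hΦ i j) _]
  simp only [LinearMap.pi_apply_eq_sum_univ (jetForm m l) (thirdJet _ _), smul_eq_mul]
  exact integrable_finsetSum _ fun p _ => (hS.integrable_thirdJet hΦ x p).mul_const _

theorem P_integral {A : Type*} [MeasurableSpace A] {μ : Measure A} {S : Set (A → E3 → ℝ)}
    (hS : IsDominatedClass μ S) {Φ : A → TensorField}
    (hΦ : ∀ i j, (fun a x => Φ a x i j) ∈ S) :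
    (∀ i j, ContDiff ℝ ∞ fun x => ∫ a, Φ a x i j ∂μ) ∧
      ∀ x m l, P (fun x i j => ∫ a, Φ a x i j ∂μ) x m l = ∫ a, P (Φ a) x m l ∂μ := by
  have hsm := fun i j => (hS.contDiff_integral (hΦ i j)).1
  refine ⟨hsm, fun x m l => ?_⟩
  have hder : ∀ {Ψ : A → E3 → ℝ}, Ψ ∈ S → ∀ i, (fun a => pd i (Ψ a)) ∈ S :=
    fun hΨ i => hS.deriv _ hΨ _
  have hpd : ∀ {Ψ : A → E3 → ℝ}, Ψ ∈ S → ∀ i,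
      pd i (fun x => ∫ a, Ψ a x ∂μ) = fun x => ∫ a, pd i (Ψ a) x ∂μ :=
    fun hΨ i => funext fun x => (hS.contDiff_integral hΨ).2 x _
  have hjet : ∀ p, thirdJet (fun x i j => ∫ a, Φ a x i j ∂μ) x p
      = ∫ a, thirdJet (Φ a) x p ∂μ := by
    intro p
    have h0 := hΦ p.2.2.2.1 p.2.2.2.2
    simp only [thirdJet]
    rw [hpd h0, hpd (hder h0 _), hpd (hder (hder h0 _) _)]
  have hint := hS.integrable_thirdJet hΦ x
  rw [P_eq_jetForm hsm]
  simp only [P_eq_jetForm fun i j => hS.smooth _ (hΦ i j) _]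
  obtain ⟨c, hc⟩ : ∃ c : JetIndex → ℝ, ∀ f, jetForm m l f = ∑ p, f p * c p :=
    ⟨_, fun f => LinearMap.pi_apply_eq_sum_univ _ f⟩
  simp only [hc, hjet]
  rw [integral_finsetSum _ fun p _ => (hint p).mul_const _]
  simp only [integral_mul_const]

end TTPotential
end

noncomputable section

namespace TTPotential

open MeasureTheory Metric Set

/-! ### The explicit potential -/

theorem P_const_mul {u : TensorField} (hu : ∀ i j, ContDiff ℝ ∞ fun x => u x i j) (c : ℝ) (x : E3)
    (m l : Fin 3) : P (fun x i j => c * u x i j) x m l = c * P u x m l := by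
  have hcu : ∀ i j, ContDiff ℝ ∞ fun x => c * u x i j := fun i j => contDiff_const.mul (hu i j)
  have hpd : ∀ {f : E3 → ℝ}, ContDiff ℝ ∞ f → ∀ i, pd i (fun x => c * f x) = fun x => c * pd i f x :=
    fun hf i => pd_const_smul hf c i
  rw [P_eq_jetForm hcu, P_eq_jetForm hu, ← smul_eq_mul, ← map_smul]
  congr 1
  funext p
  have h0 := hu p.2.2.2.1 p.2.2.2.2
  simp only [thirdJet, Pi.smul_apply, smul_eq_mul]
  rw [hpd h0, hpd (contDiff_pd h0 _), hpd (contDiff_pd (contDiff_pd h0 _) _)]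

/-- Linearity in `H`, with coefficients polynomial in `X`. The coefficients can be pulled out of
integrals in t or absorbed into test functions of the base point. -/
theorem aCubic_eq_sum (X : Fin 3 → ℝ) (H : Fin 3 → Fin 3 → ℝ) (j l : Fin 3) :
    aCubic X H j l
      = ∑ p : Fin 3 × Fin 3, aCubic X (fun a b => if p = (a, b) then 1 else 0) j l * H p.1 p.2 := by
  let L : (Fin 3 × Fin 3 → ℝ) →ₗ[ℝ] ℝ :=
    { toFun := fun H => aCubic X (fun a b => H (a, b)) j l
      map_add' := fun H K => by
        simp only [aCubic, Pi.add_apply, Fin.sum_univ_three]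
        ring
      map_smul' := fun c H => by
        simp only [aCubic, Pi.smul_apply, Fin.sum_univ_three, smul_eq_mul, RingHom.id_apply]
        ring }
  have := LinearMap.pi_apply_eq_sum_univ L fun p => H p.1 p.2
  simp only [smul_eq_mul, mul_comm (H _ _)] at this
  exact this

theorem integral_aCubic {A : Type*} [MeasurableSpace A] {μ : Measure A} {w : A → ℝ}
    {H : A → Fin 3 → Fin 3 → ℝ} (hH : ∀ i j, Integrable (fun a => w a * H a i j) μ)
    (X : Fin 3 → ℝ) (j l : Fin 3) :
    ∫ a, w a * aCubic X (H a) j l ∂μ = aCubic X (fun i j => ∫ a, w a * H a i j ∂μ) j l := by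
  obtain ⟨c, hc⟩ : ∃ c : Fin 3 × Fin 3 → ℝ, ∀ H : Fin 3 → Fin 3 → ℝ,
      aCubic X H j l = ∑ p, c p * H p.1 p.2 := ⟨_, fun H => aCubic_eq_sum X H j l⟩
  simp only [hc, Finset.mul_sum, mul_left_comm (w _)]
  rw [integral_finsetSum _ fun p _ => (hH p.1 p.2).const_mul _]
  simp only [integral_const_mul]

theorem contDiff_aCubic {E : Type*} [NormedAddCommGroup E] [NormedSpace ℝ E]
    {X : E → Fin 3 → ℝ} {H : E → Fin 3 → Fin 3 → ℝ} (hX : ∀ i, ContDiff ℝ ∞ fun e => X e i)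
    (hH : ∀ i j, ContDiff ℝ ∞ fun e => H e i j) (j l : Fin 3) :
    ContDiff ℝ ∞ fun e => aCubic (X e) (H e) j l := by
  simp only [aCubic, Fin.sum_univ_three]
  fun_prop

theorem contDiff_dil_prod : ContDiff ℝ ∞ fun p : ℝ × E3 × E3 => dil p.1 p.2.1 p.2.2 := by
  unfold dil
  fun_prop

theorem contDiff_cubicField_prod {h : TensorField} (hh : ∀ i j, ContDiff ℝ ∞ fun x => h x i j)
    (j l : Fin 3) :
    ContDiff ℝ ∞ fun p : ℝ × E3 × E3 => cubicField h p.1 p.2.2 p.2.1 j l :=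
  contDiff_const.mul (contDiff_aCubic
    (fun i => ((contDiff_coord i).comp (contDiff_fst.comp contDiff_snd)).sub
      ((contDiff_coord i).comp (contDiff_snd.comp contDiff_snd)))
    (fun i j => (hh i j).comp contDiff_dil_prod) j l)

/-- The weight `t (1 - t)²` on the unit interval. -/
def unitWeight : ℝ → ℝ := (Icc (0 : ℝ) 1).indicator fun t => t * (1 - t) ^ 2

theorem integrable_unitWeight : Integrable unitWeight :=
  (integrable_indicator_iff measurableSet_Icc).2
    (Continuous.continuousOn (by fun_prop)).integrableOn_Icc

theorem unitWeight_eq_zero {t : ℝ} (ht : t ∉ Icc (0 : ℝ) 1) : unitWeight t = 0 :=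
  indicator_of_notMem ht _

theorem integral_unitWeight_mul (f : ℝ → ℝ) :
    ∫ t, unitWeight t * f t = ∫ t in (0 : ℝ)..1, f t * (t * (1 - t) ^ 2) := by
  rw [intervalIntegral.integral_of_le zero_le_one, ← integral_Icc_eq_integral_Ioc,
    ← integral_indicator measurableSet_Icc]
  congr 1
  funext t
  by_cases ht : t ∈ Icc (0 : ℝ) 1 <;> simp [unitWeight, ht, mul_comm]

theorem isDominatedClass_unitWeight : IsDominatedClass volume (weighted E3 unitWeight) :=
  isDominatedClass_weighted integrable_unitWeight isCompact_Icc fun _ => unitWeight_eq_zero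

theorem dil_zero (t : ℝ) (x : E3) : dil t x 0 = t • x := by simp [dil]

theorem explicitPotential_eq {h : TensorField} (hh : ∀ i j, ContDiff ℝ ∞ fun x => h x i j)
    (x : E3) (j l : Fin 3) :
    explicitPotential h x j l = ∫ t, unitWeight t * cubicField h t 0 x j l := by
  have hcont : ∀ i k, Continuous fun t : ℝ => h (t • x) i k :=
    fun i k => (hh i k).continuous.comp (by fun_prop)
  have hint : ∀ i k, Integrable fun t => unitWeight t * h (t • x) i k := by
    intro i k
    have : (fun t => unitWeight t * h (t • x) i k)
        = (Icc (0 : ℝ) 1).indicator fun t => t * (1 - t) ^ 2 * h (t • x) i k := by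
      funext t
      by_cases ht : t ∈ Icc (0 : ℝ) 1 <;> simp [unitWeight, ht]
    rw [this, integrable_indicator_iff measurableSet_Icc]
    exact (Continuous.continuousOn (by have := hcont i k; fun_prop)).integrableOn_Icc
  have hsig : ∀ i j k, sigma h i j k x
      = ∑ l, eps i j l * ∫ t, unitWeight t * h (t • x) l k := by
    intro i j k
    rw [sigma, ← integral_unitWeight_mul]
    simp only [Finset.mul_sum, mul_left_comm (unitWeight _)]
    rw [integral_finsetSum _ fun p _ => (hint p k).const_mul _]
    simp only [integral_const_mul]
  have hR : ∫ t, unitWeight t * cubicField h t 0 x j l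
      = 1 / 2 * aCubic (fun i => x i) (fun i k => ∫ t, unitWeight t * h (t • x) i k) j l := by
    rw [← integral_aCubic hint, ← integral_const_mul]
    congr 1
    funext t
    simp only [cubicField, dil_zero, PiLp.zero_apply, sub_zero]
    ring
  rw [hR]
  simp only [explicitPotential, hsig, EuclideanSpace.norm_sq_eq, Real.norm_eq_abs, sq_abs]
  -- Replacing the integrals by unknowns `M i k` leaves a polynomial identity between the two forms
  -- of the cubic expression.
  obtain ⟨M, hM⟩ : ∃ M : Fin 3 → Fin 3 → ℝ, ∀ i k, ∫ t, unitWeight t * h (t • x) i k = M i k :=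
    ⟨_, fun i k => rfl⟩
  simp only [hM]
  clear hR hsig hint hcont
  fin_cases j <;> fin_cases l <;>
  · simp [aCubic, Fin.sum_univ_three, eps, fin3_22]
    ring

/-- Three integrations by parts: with q the quadratic, the terms carry q, -q' and q'', and their
derivatives telescope because q''' = 0. -/
theorem hasDerivAt_primitive {f : E3 → ℝ} (hf : ContDiff ℝ ∞ f) (x y : E3) (a b c t : ℝ) :
    HasDerivAt (fun t => 1 / 2 * ((a + b * t + c * t ^ 2) * (t ^ 2 * shift y 3 (shift y 4 f) (dil t x y))
        - (b + 2 * c * t) * (t ^ 3 * shift y 4 f (dil t x y)) + 2 * c * (t ^ 4 * f (dil t x y))))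
      ((a + b * t + c * t ^ 2) * t * (1 / 2 * shift3 y f (dil t x y))) t := by
  have h4 := hasDerivAt_dil hf x y 3 t
  have h3 := hasDerivAt_dil (contDiff_shift y 4 hf) x y 2 t
  have h2 := hasDerivAt_dil (contDiff_shift y 3 (contDiff_shift y 4 hf)) x y 1 t
  norm_num at h4 h3 h2
  have hw : HasDerivAt (fun t : ℝ => a + b * t + c * t ^ 2) (b + 2 * c * t) t := by
    have := (((hasDerivAt_id t).const_mul b).const_add a).add ((hasDerivAt_pow 2 t).const_mul c)
    refine this.congr_deriv ?_
    simp
    ring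
  have hw' : HasDerivAt (fun t : ℝ => b + 2 * c * t) (2 * c) t := by
    simpa using ((hasDerivAt_id t).const_mul (2 * c)).const_add b
  refine ((((hw.mul h2).sub (hw'.mul h3)).add (h4.const_mul (2 * c))).const_mul
    (1 / 2)).congr_deriv ?_
  simp only [shift3]
  ring

/-- Every TT tensor is `P` of its explicit potential. -/
theorem IsTT.explicitPotential {h : TensorField} (hh : IsTT h) :
    IsSymTraceless (explicitPotential h) ∧ P (explicitPotential h) = h := by
  have hc := hh.contDiff
  have hE := explicitPotential_eq hc
  have hEf : TTPotential.explicitPotential h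
      = fun x j l => ∫ t, unitWeight t * cubicField h t 0 x j l := by
    funext x j l
    exact hE x j l
  have hmem : ∀ i j, (fun t x => unitWeight t * cubicField h t 0 x i j)
      ∈ weighted E3 unitWeight := fun i j =>
    ⟨_, (contDiff_cubicField_prod hc i j).comp
      (contDiff_fst.prodMk (contDiff_snd.prodMk contDiff_const)), rfl⟩
  obtain ⟨hs, hP⟩ := P_integral isDominatedClass_unitWeight
    (Φ := fun t x i j => unitWeight t * cubicField h t 0 x i j) hmem
  rw [← hEf] at hP
  refine ⟨⟨?_, ?_, ?_⟩, ?_⟩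
  · rw [hEf]
    exact contDiff_pi.2 fun i => contDiff_pi.2 fun j => hs i j
  · intro x i j
    simp only [hE, cubicField, aCubic_symm _ _ i j]
  · intro x
    simp only [hE]
    rw [← integral_finsetSum _ fun i _ => isDominatedClass_unitWeight.integrable (hmem i i) x]
    simp only [← Finset.mul_sum, cubicField, aCubic_traceless _ (hh.symm _), mul_zero,
      integral_zero]
  · funext x m l
    rw [hP]
    simp only [P_const_mul (fun i j => contDiff_cubicField hc _ 0 i j), P_cubicField hh]
    rw [integral_unitWeight_mul]
    -- The quadratic is (1 - t)², with q = q' = 0 and q'' = 2 at t = 1, where the primitive is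
    -- therefore h. At t = 0 the powers of t kill every term.
    have hderiv := fun t => hasDerivAt_primitive (hc m l) x 0 1 (-2) 1 t
    rw [intervalIntegral.integral_congr (g := fun t => (1 + (-2) * t + 1 * t ^ 2) * t
      * (1 / 2 * shift3 0 (fun x => h x m l) (dil t x 0))) fun t _ => by ring]
    rw [intervalIntegral.integral_eq_sub_of_hasDerivAt fun t _ => hderiv t]
    · simp [dil]
      ring
    · refine Continuous.intervalIntegrable ?_ _ _
      have : Continuous fun t : ℝ => shift3 0 (fun x => h x m l) (dil t x 0) :=
        (contDiff_shift 0 2 (contDiff_shift 0 3 (contDiff_shift 0 4 (hc m l)))).continuous.comp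
          (by unfold dil; fun_prop)
      fun_prop

end TTPotential
end

noncomputable section

namespace TTPotential

open MeasureTheory Metric Set

/-! ### Test functions and averages over the base point -/

/-- Smooth functions of `x` and `y` that vanish unless `y` lies in the closed unit ball. -/
structure IsTest (g : E3 → E3 → ℝ) : Prop where
  smooth : ContDiff ℝ ∞ fun p : E3 × E3 => g p.1 p.2
  supp : ∀ x y, y ∉ closedBall (0 : E3) 1 → g x y = 0

/-- The characteristic function of the closed unit ball. -/
def ballWeight : E3 → ℝ := (closedBall (0 : E3) 1).indicator 1

theorem integrable_ballWeight : Integrable ballWeight :=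
  (integrable_indicator_iff measurableSet_closedBall).2
    (integrableOn_const (isCompact_closedBall _ _).measure_lt_top.ne)

theorem isDominatedClass_ballWeight (E : Type*) [NormedAddCommGroup E] [NormedSpace ℝ E]
    [FiniteDimensional ℝ E] : IsDominatedClass volume (weighted E ballWeight) :=
  isDominatedClass_weighted integrable_ballWeight (isCompact_closedBall _ _)
    fun _ h => indicator_of_notMem h _

theorem IsTest.ballWeight_mul {g : E3 → E3 → ℝ} (hg : IsTest g) (x y : E3) :
    ballWeight y * g x y = g x y := by
  by_cases hy : y ∈ closedBall (0 : E3) 1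
  · simp [ballWeight, indicator_of_mem hy]
  · simp [hg.supp x y hy]

theorem IsTest.section_smooth {g : E3 → E3 → ℝ} (hg : IsTest g) (x : E3) : ContDiff ℝ ∞ (g x) :=
  contDiff_section hg.smooth x

theorem IsTest.contDiff_swap {g : E3 → E3 → ℝ} (hg : IsTest g) :
    ContDiff ℝ ∞ fun p : E3 × E3 => g p.2 p.1 :=
  hg.smooth.comp (contDiff_snd.prodMk contDiff_fst)

theorem IsTest.pdX {g : E3 → E3 → ℝ} (hg : IsTest g) (i : Fin 3) :
    IsTest fun x y => pd i (fun x => g x y) x where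
  smooth := (contDiff_partial_fderiv (F := fun y x => g x y) hg.contDiff_swap (EuclideanSpace.single i (1 : ℝ))).comp
    (contDiff_snd.prodMk contDiff_fst)
  supp x y hy := by
    have : (fun x => g x y) = fun _ => 0 := funext fun x => hg.supp x y hy
    simp [this, pd]

theorem IsTest.pdY {g : E3 → E3 → ℝ} (hg : IsTest g) (i : Fin 3) :
    IsTest fun x y => pd i (g x) y where
  smooth := contDiff_partial_fderiv hg.smooth _
  supp x y hy := by
    have : g x =ᶠ[nhds y] fun _ => 0 := by
      filter_upwards [isClosed_closedBall.isOpen_compl.mem_nhds hy] with z hz using hg.supp x z hz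
    simp [pd, this.fderiv_eq]

theorem IsTest.mul {g : E3 → E3 → ℝ} (hg : IsTest g) {k : E3 → E3 → ℝ}
    (hk : ContDiff ℝ ∞ fun p : E3 × E3 => k p.1 p.2) : IsTest fun x y => k x y * g x y where
  smooth := hk.mul hg.smooth
  supp x y hy := by simp [hg.supp x y hy]

theorem IsTest.hasCompactSupport {g : E3 → E3 → ℝ} (hg : IsTest g) (x : E3) :
    HasCompactSupport (g x) :=
  HasCompactSupport.intro (isCompact_closedBall 0 1) (hg.supp x)

/-- The average of a dilated function over the base point of the dilation. -/
def avg (g : E3 → E3 → ℝ) (f : E3 → ℝ) (t : ℝ) (x : E3) : ℝ := ∫ y, g x y * f (dil t x y)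

theorem continuous_dil_base (t : ℝ) (x : E3) : Continuous fun y => dil t x y := by
  unfold dil
  fun_prop

theorem contDiff_dil_base (t : ℝ) (x : E3) : ContDiff ℝ ∞ fun y => dil t x y := by
  unfold dil
  fun_prop

theorem IsTest.integrable_mul {g : E3 → E3 → ℝ} (hg : IsTest g) {f : E3 → ℝ} (hf : Continuous f)
    (x : E3) : Integrable fun y => g x y * f y :=
  ((hg.section_smooth x).continuous.mul hf).integrable_of_hasCompactSupport
    ((hg.hasCompactSupport x).mul_right)

theorem pd_comp_dil_base {f : E3 → ℝ} (hf : ContDiff ℝ ∞ f) (t : ℝ) (x : E3) (i : Fin 3) (y : E3) :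
    pd i (fun y => f (dil t x y)) y = (1 - t) * pd i f (dil t x y) := by
  have h1 : HasFDerivAt (fun y => dil t x y) ((1 - t) • ContinuousLinearMap.id ℝ E3) y := by
    have := (hasFDerivAt_id (𝕜 := ℝ) y).add (((hasFDerivAt_id (𝕜 := ℝ) y).const_sub x).const_smul t)
    refine this.congr_fderiv ?_
    ext v
    simp
    ring
  have h2 := (differentiable_of_contDiff hf (dil t x y)).hasFDerivAt.comp y h1
  rw [pd, show (fun y => f (dil t x y)) = f ∘ fun y => dil t x y from rfl, h2.fderiv]
  simp [pd]

/-- Integration by parts in the base point. -/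
theorem avg_pd {g : E3 → E3 → ℝ} (hg : IsTest g) {f : E3 → ℝ} (hf : ContDiff ℝ ∞ f) {t : ℝ}
    (ht : t ≠ 1) (x : E3) (i : Fin 3) :
    avg g (pd i f) t x = (t - 1)⁻¹ * avg (fun x y => pd i (g x) y) f t x := by
  have hF : ContDiff ℝ ∞ fun y => f (dil t x y) := hf.comp (contDiff_dil_base t x)
  have key := integral_mul_fderiv_eq_neg_fderiv_mul_of_integrable (μ := (volume : Measure E3))
    (f := g x) (g := fun y => f (dil t x y)) (v := EuclideanSpace.single i (1 : ℝ))
    ((hg.pdY i).integrable_mul hF.continuous x)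
    (hg.integrable_mul (contDiff_pd hF i).continuous x)
    (hg.integrable_mul hF.continuous x)
    (fun y _ => differentiable_of_contDiff (hg.section_smooth x) y)
    (fun y _ => differentiable_of_contDiff hF y)
  have h1 : ∫ y, g x y * fderiv ℝ (fun y => f (dil t x y)) y (EuclideanSpace.single i (1 : ℝ))
      = (1 - t) * avg g (pd i f) t x := by
    rw [avg, ← integral_const_mul]
    congr 1
    funext y
    have := pd_comp_dil_base hf t x i y
    rw [pd] at this
    rw [this]
    ring
  rw [h1] at key
  have h2 : ∫ y, fderiv ℝ (g x) y (EuclideanSpace.single i (1 : ℝ)) * f (dil t x y)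
      = avg (fun x y => pd i (g x) y) f t x := rfl
  rw [h2] at key
  have ht' : t - 1 ≠ 0 := sub_ne_zero.2 ht
  field_simp
  linear_combination -key

/-- The redundant factor exhibits the average as an integral with compactly supported weight, to
which the dominated classes apply. -/
theorem avg_eq_ballWeight {g : E3 → E3 → ℝ} (hg : IsTest g) (f : E3 → ℝ) (t : ℝ) (x : E3) :
    avg g f t x = ∫ y, ballWeight y * (g x y * f (dil t x y)) := by
  simp only [avg, ← mul_assoc, hg.ballWeight_mul]

theorem contDiff_avg {g : E3 → E3 → ℝ} (hg : IsTest g) {f : E3 → ℝ} (hf : ContDiff ℝ ∞ f) :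
    ContDiff ℝ ∞ fun p : ℝ × E3 => avg g f p.1 p.2 := by
  simp only [avg_eq_ballWeight hg]
  refine ((isDominatedClass_ballWeight (ℝ × E3)).contDiff_integral
    (Φ := fun y p => ballWeight y * (g p.2 y * f (dil p.1 p.2 y))) ⟨_, ?_, rfl⟩).1
  exact (hg.smooth.comp ((contDiff_snd.comp contDiff_snd).prodMk contDiff_fst)).mul
    (hf.comp (contDiff_dil_prod.comp ((contDiff_fst.comp contDiff_snd).prodMk
      ((contDiff_snd.comp contDiff_snd).prodMk contDiff_fst))))

/-- Differentiating the dilated function produces t ∂f, and `avg_pd` trades the ∂ for a derivative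
of the test function. No derivative of f is left, only the factor t / (t - 1), which is bounded for
large t. -/
theorem pd_avg {g : E3 → E3 → ℝ} (hg : IsTest g) {f : E3 → ℝ} (hf : ContDiff ℝ ∞ f) {t : ℝ}
    (ht : t ≠ 1) (x : E3) (i : Fin 3) :
    pd i (avg g f t) x = avg (fun x y => pd i (fun x => g x y) x) f t x
      + t / (t - 1) * avg (fun x y => pd i (g x) y) f t x := by
  have hmem : (fun (y : E3) (x : E3) => ballWeight y * (g x y * f (dil t x y)))
      ∈ weighted E3 ballWeight :=
    ⟨_, hg.contDiff_swap.mul (hf.comp (contDiff_dil_prod.comp (contDiff_const.prodMk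
      (contDiff_snd.prodMk contDiff_fst)))), rfl⟩
  have key := ((isDominatedClass_ballWeight E3).contDiff_integral hmem).2 x
    (EuclideanSpace.single i (1 : ℝ))
  have h1 : (fun x => ∫ y, ballWeight y * (g x y * f (dil t x y))) = avg g f t :=
    funext fun x => (avg_eq_ballWeight hg f t x).symm
  rw [h1] at key
  rw [pd, key, div_eq_mul_inv, mul_assoc, ← avg_pd hg hf ht, avg, avg, ← integral_const_mul,
    ← integral_add]
  · congr 1
    funext y
    have hgs : ContDiff ℝ ∞ fun x => g x y := contDiff_section (F := fun y x => g x y) hg.contDiff_swap y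
    have hfs : ContDiff ℝ ∞ fun x => f (dil t x y) := hf.comp (contDiff_dil t y)
    have h2 : pd i (fun x => ballWeight y * (g x y * f (dil t x y))) x
        = ballWeight y * (g x y * (t * pd i f (dil t x y))
          + f (dil t x y) * pd i (fun x => g x y) x) := by
      have e1 := congrFun (pd_const_smul (hgs.mul hfs) (ballWeight y) i) x
      have e2 := congrFun (pd_mul hgs hfs i) x
      simp only [Pi.add_apply, Pi.mul_apply, Pi.smul_apply, smul_eq_mul, pd_comp_dil hf] at e1 e2
      rw [← e2]
      exact e1
    rw [pd] at h2
    rw [h2]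
    have e3 := hg.ballWeight_mul x y
    have e4 := (hg.pdX i).ballWeight_mul x y
    simp only [mul_add]
    linear_combination (t * pd i f (dil t x y)) * e3 + f (dil t x y) * e4
  · exact (hg.pdX i).integrable_mul (hf.continuous.comp (continuous_dil_base t x)) x
  · exact (hg.integrable_mul ((contDiff_pd hf i).continuous.comp
      (continuous_dil_base t x)) x).const_mul t

end TTPotential
end

noncomputable section

namespace TTPotential

open MeasureTheory Metric Set

/-! ### Decay of averages of TT tensors -/

/-- A TT tensor is a double divergence of its quadratic moments. -/
theorem IsTT.eq_pd_pd {h : TensorField} (hh : IsTT h) (x : E3) (i j : Fin 3) :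
    h x i j = 1 / 2 * ∑ k, ∑ l, pd k (pd l fun z => z i * z j * h z k l) x := by
  have hc := hh.contDiff
  let X : Fin 3 → smoothAlg := fun i => ⟨fun x => x i, contDiff_coord i⟩
  let H := bundle h hc
  have hX : ∀ i j, pdD i (X j) = if i = j then 1 else 0 := by
    intro i j
    refine Subtype.ext ?_
    have := pd_coord i j 0
    simp only [sub_zero] at this
    refine (show _ = _ from this).trans ?_
    split_ifs <;> rfl
  have hs : ∀ i j, H i j = H j i := fun i j => Subtype.ext (funext fun x => hh.symm x i j)
  have hdiv' : ∀ j, ∑ i, pdD i (H i j) = 0 := fun j => Subtype.ext (funext fun x => by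
    simpa [H, bundle, Fin.sum_univ_three, pdD_coe] using hh.transverse x j)
  have hdiv : ∀ j, ∑ i, pdD i (H j i) = 0 := by
    intro j
    simp only [hs j]
    exact hdiv' j
  -- As H is divergence-free, each divergence differentiates only the coordinate factors. Two of
  -- them therefore consume both factors and leave two copies of `H i j`.
  have hdiv : ∀ k, ∑ l, pdD l (X i * X j * H k l) = X j * H k i + X i * H k j := by
    intro k
    simp only [Derivation.leibniz, hX, smul_eq_mul, Finset.sum_add_distrib, ← Finset.mul_sum, hdiv,
      mul_add, mul_ite, mul_one, mul_zero, Finset.sum_ite_eq', Finset.mem_univ, if_true]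
    ring
  have main : ∑ k, ∑ l, pdD k (pdD l (X i * X j * H k l)) = 2 * H i j := by
    simp only [← map_sum, hdiv]
    simp only [map_add, Derivation.leibniz, hX, smul_eq_mul,
      Finset.sum_add_distrib, ← Finset.mul_sum, hdiv', mul_ite, mul_one, mul_zero,
      Finset.sum_ite_eq', Finset.mem_univ, if_true]
    rw [hs j i]
    ring
  have := congrFun (congrArg Subtype.val main) x
  have h2 : (2 * H i j : smoothAlg).1 x = 2 * h x i j := rfl
  rw [h2] at this
  simp only [Fin.sum_univ_three] at this ⊢
  have e : ∀ k l, (pdD k (pdD l (X i * X j * H k l))).1 x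
      = pd k (pd l fun z => z i * z j * h z k l) x := fun k l => rfl
  simp only [← e]
  have e2 : (1 / 2 : ℝ) * (2 * h x i j) = h x i j := by ring
  rw [← e2, ← this]
  rfl

theorem dil_eq_smul {t : ℝ} (ht : t ≠ 1) (x y : E3) :
    dil t x y = (t - 1) • ((t / (t - 1)) • x - y) := by
  have : t - 1 ≠ 0 := sub_ne_zero.2 ht
  rw [smul_sub, smul_smul, mul_div_cancel₀ _ this, dil, smul_sub, sub_smul, one_smul]
  abel

/-- The singular weight `‖·‖ ^ s` is uniformly integrable on unit balls. -/
theorem exists_integral_norm_rpow_le {s : ℝ} (hs : -3 < s) (R : ℝ) :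
    ∃ K, 0 ≤ K ∧ ∀ ξ : E3, ‖ξ‖ ≤ R →
      IntegrableOn (fun y => ‖ξ - y‖ ^ s) (closedBall 0 1) ∧
      ∫ y in closedBall (0 : E3) 1, ‖ξ - y‖ ^ s ≤ K := by
  have hloc : LocallyIntegrable (fun w : E3 => ‖w‖ ^ s) := by
    refine locallyIntegrable_of_norm_le_rpow (C := 1) (α := -s) (by simp) (by simp; linarith)
      (.of_forall fun w => ?_) ?_
    · rw [Real.norm_of_nonneg (Real.rpow_nonneg (norm_nonneg _) _), neg_neg, one_mul]
    · exact (measurable_norm.pow_const s).aestronglyMeasurable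
  have hint : IntegrableOn (fun w : E3 => ‖w‖ ^ s) (closedBall 0 (R + 1)) :=
    hloc.integrableOn_isCompact (isCompact_closedBall _ _)
  refine ⟨∫ w in closedBall (0 : E3) (R + 1), ‖w‖ ^ s,
    integral_nonneg fun w => Real.rpow_nonneg (norm_nonneg _) _, fun ξ hξ => ?_⟩
  set G : E3 → ℝ := (closedBall (0 : E3) (R + 1)).indicator fun w => ‖w‖ ^ s
  have hG : Integrable G := (integrable_indicator_iff measurableSet_closedBall).2 hint
  have hGt : Integrable fun y => G (ξ - y) := hG.comp_sub_left ξ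
  have hG0 : ∀ w, 0 ≤ G w := fun w =>
    indicator_nonneg (fun w _ => Real.rpow_nonneg (norm_nonneg _) _) w
  have hle : EqOn (fun y => G (ξ - y)) (fun y => ‖ξ - y‖ ^ s) (closedBall 0 1) := by
    intro y hy
    refine indicator_of_mem ?_ _
    rw [mem_closedBall_zero_iff] at hy ⊢
    linarith [norm_sub_le ξ y]
  refine ⟨(integrableOn_congr_fun hle measurableSet_closedBall).1 hGt.integrableOn, ?_⟩
  rw [← setIntegral_congr_fun measurableSet_closedBall hle]
  calc ∫ y in closedBall (0 : E3) 1, G (ξ - y) ≤ ∫ y, G (ξ - y) :=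
        setIntegral_le_integral hGt (.of_forall fun y => hG0 _)
    _ = ∫ w, G w := integral_sub_left_eq_self G volume ξ
    _ = _ := integral_indicator measurableSet_closedBall

theorem IsTest.exists_bound {g : E3 → E3 → ℝ} (hg : IsTest g) (R : ℝ) :
    ∃ M, 0 ≤ M ∧ ∀ x y, ‖x‖ ≤ R → |g x y| ≤ M := by
  obtain ⟨M, hM⟩ := ((isCompact_closedBall (0 : E3) R).prod
    (isCompact_closedBall (0 : E3) 1)).bddAbove_image hg.smooth.continuous.norm.continuousOn
  refine ⟨max M 0, le_max_right _ _, fun x y hx => ?_⟩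
  by_cases hy : y ∈ closedBall (0 : E3) 1
  · exact (hM (mem_image_of_mem _ (mk_mem_prod (mem_closedBall_zero_iff.2 hx) hy))).trans
      (le_max_left _ _)
  · simp [hg.supp x y hy]

/-- Averages of a function of size `‖z‖ ^ s`. -/
theorem exists_avg_le {g : E3 → E3 → ℝ} (hg : IsTest g) {f : E3 → ℝ} {s C : ℝ}
    (hs : -3 < s) (hC : ∀ z, |f z| ≤ C * ‖z‖ ^ s) (R : ℝ) :
    ∃ K, 0 ≤ K ∧ ∀ t x, 2 ≤ t → ‖x‖ ≤ R → |avg g f t x| ≤ K * (t - 1) ^ s := by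
  obtain ⟨M, hM0, hM⟩ := hg.exists_bound R
  obtain ⟨K, hK0, hK⟩ := exists_integral_norm_rpow_le hs (2 * R)
  have hCn : 0 ≤ C := by
    have := (abs_nonneg _).trans (hC (EuclideanSpace.single 0 1))
    simpa using this
  refine ⟨M * C * K, by positivity, fun t x ht hx => ?_⟩
  have ht1 : 0 < t - 1 := by linarith
  -- The dilated point is (t - 1)(ξ - y), so the singularity lies at y = ξ. For t ≥ 2 the ratio is
  -- at most 2, which keeps ξ in a fixed ball.
  have hξ : ‖(t / (t - 1)) • x‖ ≤ 2 * R := by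
    rw [norm_smul, Real.norm_of_nonneg (by positivity)]
    refine mul_le_mul ?_ hx (norm_nonneg _) (by norm_num)
    rw [div_le_iff₀ ht1]
    linarith
  obtain ⟨hi, hb⟩ := hK _ hξ
  set ξ := (t / (t - 1)) • x
  have hset : avg g f t x = ∫ y in closedBall (0 : E3) 1, g x y * f (dil t x y) := by
    refine (setIntegral_eq_integral_of_forall_compl_eq_zero fun y hy => ?_).symm
    simp [hg.supp x y hy]
  rw [hset, ← Real.norm_eq_abs]
  refine (norm_integral_le_of_norm_le (g := fun y => M * C * (t - 1) ^ s * ‖ξ - y‖ ^ s)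
    (hi.const_mul _) (.of_forall fun y => ?_)).trans ?_
  · rw [Real.norm_eq_abs, abs_mul]
    have h1 : |f (dil t x y)| ≤ C * ((t - 1) ^ s * ‖ξ - y‖ ^ s) := by
      refine (hC _).trans_eq ?_
      rw [dil_eq_smul (by linarith), norm_smul, Real.norm_of_nonneg ht1.le,
        Real.mul_rpow ht1.le (norm_nonneg _)]
    calc |g x y| * |f (dil t x y)| ≤ M * (C * ((t - 1) ^ s * ‖ξ - y‖ ^ s)) :=
          mul_le_mul (hM x y hx) h1 (abs_nonneg _) hM0
      _ = _ := by ring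
  · rw [integral_const_mul]
    calc M * C * (t - 1) ^ s * _ ≤ M * C * (t - 1) ^ s * K :=
          mul_le_mul_of_nonneg_left hb (by positivity)
      _ = _ := by ring

/-- Averages of TT tensors decay as fast as the tensors themselves, without any assumption on
derivatives. -/
theorem IsTT.exists_avg_le {h : TensorField} (hh : IsTT h) {σ C : ℝ} (hσ : -5 < σ) (hσ0 : σ ≤ 0)
    (hC : ∀ z i j, z ≠ 0 → |h z i j| ≤ C * ‖z‖ ^ σ) {g : E3 → E3 → ℝ} (hg : IsTest g)
    (i j : Fin 3) (R : ℝ) :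
    ∃ K, 0 ≤ K ∧ ∀ t x, 2 ≤ t → ‖x‖ ≤ R → |avg g (fun z => h z i j) t x| ≤ K * t ^ σ := by
  have hc := hh.contDiff
  -- The quadratic moments have size ‖z‖^(σ+2), and σ + 2 > -3 makes this locally integrable. The
  -- two integrations by parts return the factor (t - 1)^(-2).
  let M : Fin 3 → Fin 3 → E3 → ℝ := fun k l z => z i * z j * h z k l
  have hMs : ∀ k l, ContDiff ℝ ∞ (M k l) := fun k l =>
    ((contDiff_coord i).mul (contDiff_coord j)).mul (hc k l)
  have hMC : ∀ k l z, |M k l z| ≤ C * ‖z‖ ^ (σ + 2) := by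
    intro k l z
    have hCn : 0 ≤ C := by
      have := (abs_nonneg _).trans (hC (EuclideanSpace.single 0 1) 0 0 (by simp))
      simpa using this
    by_cases hz : z = 0
    · simp only [M, hz, PiLp.zero_apply, mul_zero, zero_mul, abs_zero]
      positivity
    · have hz0 : 0 < ‖z‖ := norm_pos_iff.2 hz
      have hi := PiLp.norm_apply_le z i
      have hj := PiLp.norm_apply_le z j
      rw [Real.norm_eq_abs] at hi hj
      simp only [M, abs_mul]
      calc |z i| * |z j| * |h z k l| ≤ ‖z‖ * ‖z‖ * (C * ‖z‖ ^ σ) :=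
            mul_le_mul (mul_le_mul hi hj (abs_nonneg _) (norm_nonneg _)) (hC z k l hz)
              (abs_nonneg _) (by positivity)
        _ = C * ‖z‖ ^ (σ + 2) := by
            rw [Real.rpow_add hz0, Real.rpow_two]
            ring
  have hgg := fun k l => (hg.pdY k).pdY l
  choose K hK0 hK using fun k l => TTPotential.exists_avg_le (hgg k l)
    (s := σ + 2) (by linarith) (hMC k l) R
  have hform : ∀ t x, t ≠ 1 → avg g (fun z => h z i j) t x
      = 1 / 2 * ((t - 1)⁻¹ * (t - 1)⁻¹) *
        ∑ k, ∑ l, avg (fun x y => pd l (fun y => pd k (g x) y) y) (M k l) t x := by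
    intro t x ht
    have h1 : avg g (fun z => h z i j) t x
        = 1 / 2 * ∑ k, ∑ l, avg g (pd k (pd l (M k l))) t x := by
      simp only [avg]
      have hI : ∀ k l, Integrable fun y => g x y * pd k (pd l (M k l)) (dil t x y) := fun k l =>
        hg.integrable_mul ((contDiff_pd (contDiff_pd (hMs k l) l) k).continuous.comp
          (continuous_dil_base t x)) x
      have e : ∀ y, g x y * h (dil t x y) i j
          = 1 / 2 * ∑ k, ∑ l, g x y * pd k (pd l (M k l)) (dil t x y) := by
        intro y
        rw [hh.eq_pd_pd (dil t x y) i j]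
        simp only [← Finset.mul_sum]
        ring
      simp only [e]
      rw [integral_const_mul, integral_finsetSum _ fun k _ => integrable_finsetSum _ fun l _ => hI k l]
      congr 1
      exact Finset.sum_congr rfl fun k _ => integral_finsetSum _ fun l _ => hI k l
    have h2 : ∀ k l, avg g (pd k (pd l (M k l))) t x = (t - 1)⁻¹ * ((t - 1)⁻¹ *
        avg (fun x y => pd l (fun y => pd k (g x) y) y) (M k l) t x) := fun k l => by
      rw [avg_pd hg (contDiff_pd (hMs k l) l) ht, avg_pd (hg.pdY k) (hMs k l) ht]
    rw [h1]
    simp only [h2, ← Finset.mul_sum]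
    ring
  refine ⟨1 / 2 * (∑ k, ∑ l, K k l) * 2 ^ (-σ), mul_nonneg (mul_nonneg (by norm_num)
    (Finset.sum_nonneg fun k _ => Finset.sum_nonneg fun l _ => hK0 k l)) (by positivity),
    fun t x ht hx => ?_⟩
  have ht1 : 0 < t - 1 := by linarith
  rw [hform t x (by linarith), abs_mul, abs_of_nonneg (by positivity)]
  have hsum : |∑ k, ∑ l, avg (fun x y => pd l (fun y => pd k (g x) y) y) (M k l) t x|
      ≤ (∑ k, ∑ l, K k l) * (t - 1) ^ (σ + 2) := by
    rw [Finset.sum_mul]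
    refine (Finset.abs_sum_le_sum_abs _ _).trans (Finset.sum_le_sum fun k _ => ?_)
    rw [Finset.sum_mul]
    exact (Finset.abs_sum_le_sum_abs _ _).trans (Finset.sum_le_sum fun l _ => hK k l t x ht hx)
  -- Here t - 1 ≥ t/2 and σ ≤ 0; this is the source of the factor 2^(-σ).
  have hpow : (t - 1) ^ σ ≤ 2 ^ (-σ) * t ^ σ := by
    have h1 : (t - 1) ^ σ ≤ (t / 2) ^ σ :=
      Real.rpow_le_rpow_of_nonpos (by linarith) (by linarith) hσ0
    rwa [Real.div_rpow (by linarith) (by norm_num), div_eq_mul_inv, ← Real.rpow_neg (by norm_num),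
      mul_comm] at h1
  calc 1 / 2 * ((t - 1)⁻¹ * (t - 1)⁻¹) * _
      ≤ 1 / 2 * ((t - 1)⁻¹ * (t - 1)⁻¹) * ((∑ k, ∑ l, K k l) * (t - 1) ^ (σ + 2)) :=
        mul_le_mul_of_nonneg_left hsum (by positivity)
    _ = 1 / 2 * (∑ k, ∑ l, K k l) * (t - 1) ^ σ := by
        rw [Real.rpow_add ht1, Real.rpow_two]
        field_simp
    _ ≤ 1 / 2 * (∑ k, ∑ l, K k l) * (2 ^ (-σ) * t ^ σ) :=
        mul_le_mul_of_nonneg_left hpow (mul_nonneg (by norm_num)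
          (Finset.sum_nonneg fun k _ => Finset.sum_nonneg fun l _ => hK0 k l))
    _ = _ := by ring

/-! ### The tails of the averaged potentials -/

/-- Finite sums of weighted averages of components of a tensor field, the weights being supported
in `(2, ∞)` and of size `t ^ n`. -/
inductive Tail (h : TensorField) (n : ℕ) : (ℝ → E3 → ℝ) → Prop
  | base (g : E3 → E3 → ℝ) (hg : IsTest g) (i j : Fin 3) (w : ℝ → ℝ) (hw : Measurable w)
      (hw0 : ∀ t, t ≤ 2 → w t = 0) (C : ℝ) (hC : ∀ t, 2 < t → |w t| ≤ C * t ^ n) :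
      Tail h n fun t x => w t * avg g (fun z => h z i j) t x
  | add (Φ Ψ : ℝ → E3 → ℝ) (hΦ : Tail h n Φ) (hΨ : Tail h n Ψ) :
      Tail h n fun t x => Φ t x + Ψ t x

theorem Tail.sum {h : TensorField} {n : ℕ} {Φ : Fin 3 → ℝ → E3 → ℝ} (hΦ : ∀ i, Tail h n (Φ i)) :
    Tail h n fun t x => ∑ i, Φ i t x := by
  simp only [Fin.sum_univ_three]
  exact .add _ _ (.add _ _ (hΦ 0) (hΦ 1)) (hΦ 2)

theorem Tail.contDiff {h : TensorField} (hh : ∀ i j, ContDiff ℝ ∞ fun x => h x i j) {n : ℕ}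
    {Φ : ℝ → E3 → ℝ} (hΦ : Tail h n Φ) (t : ℝ) : ContDiff ℝ ∞ (Φ t) := by
  induction hΦ with
  | base g hg i j w hw hw0 C hC =>
    exact contDiff_const.mul (contDiff_section (F := avg g _) (contDiff_avg hg (hh i j)) t)
  | add Φ Ψ _ _ h1 h2 => exact h1.add h2

theorem Tail.measurable {h : TensorField} (hh : ∀ i j, ContDiff ℝ ∞ fun x => h x i j) {n : ℕ}
    {Φ : ℝ → E3 → ℝ} (hΦ : Tail h n Φ) (x : E3) : Measurable fun t => Φ t x := by
  induction hΦ with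
  | base g hg i j w hw hw0 C hC =>
    exact hw.mul ((contDiff_avg hg (hh i j)).continuous.comp
      (Continuous.prodMk_left x)).measurable
  | add Φ Ψ _ _ h1 h2 => exact h1.add h2

theorem Tail.const_mul {h : TensorField} {n : ℕ} {Φ : ℝ → E3 → ℝ} (hΦ : Tail h n Φ) (c : ℝ) :
    Tail h n fun t x => c * Φ t x := by
  induction hΦ with
  | base g hg i j w hw hw0 C hC =>
    simp only [← mul_assoc]
    refine .base g hg i j _ (hw.const_mul c) (fun t ht => by simp [hw0 t ht]) (|c| * C)
      fun t ht => ?_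
    rw [abs_mul, mul_assoc]
    exact mul_le_mul_of_nonneg_left (hC t ht) (abs_nonneg c)
  | add Φ Ψ _ _ h1 h2 =>
    simp only [mul_add]
    exact .add _ _ h1 h2

/-- By `pd_avg` a derivative changes the test function and multiplies the weight by at most t / (t -
1) ≤ 2, so the growth exponent `n` stays the same. Weights vanish for t ≤ 2, away from the singular
value t = 1. -/
theorem Tail.pd {h : TensorField} (hh : ∀ i j, ContDiff ℝ ∞ fun x => h x i j) {n : ℕ}
    {Φ : ℝ → E3 → ℝ} (hΦ : Tail h n Φ) (k : Fin 3) : Tail h n fun t => pd k (Φ t) := by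
  induction hΦ with
  | base g hg i j w hw hw0 C hC =>
    have e : (fun t => TTPotential.pd k fun x => w t * avg g (fun z => h z i j) t x)
        = fun t x => w t * avg (fun x y => TTPotential.pd k (fun x => g x y) x)
            (fun z => h z i j) t x
          + w t * (t / (t - 1)) * avg (fun x y => TTPotential.pd k (g x) y)
            (fun z => h z i j) t x := by
      funext t x
      have h1 := congrFun (pd_const_smul (contDiff_section (F := avg g _)
        (contDiff_avg hg (hh i j)) t) (w t) k) x
      refine h1.trans ?_
      simp only [Pi.smul_apply, smul_eq_mul]
      by_cases ht : t ≤ 2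
      · simp [hw0 t ht]
      · rw [pd_avg hg (hh i j) (by linarith [not_le.1 ht])]
        ring
    rw [e]
    refine .add _ _ (.base _ (hg.pdX k) i j w hw hw0 C hC) (.base _ (hg.pdY k) i j _
      (hw.mul (measurable_id.div (measurable_id.sub_const 1))) (fun t ht => by simp [hw0 t ht])
      (C * 2) fun t ht => ?_)
    have ht1 : 0 < t - 1 := by linarith
    have h2 : |t / (t - 1)| ≤ 2 := by
      rw [abs_of_nonneg (by positivity), div_le_iff₀ ht1]
      linarith
    rw [abs_mul]
    calc |w t| * |t / (t - 1)| ≤ C * t ^ n * 2 :=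
          mul_le_mul (hC t ht) h2 (abs_nonneg _) ((abs_nonneg _).trans (hC t ht))
      _ = _ := by ring
  | add Φ Ψ hΦ hΨ h1 h2 =>
    have e : (fun t => TTPotential.pd k fun x => Φ t x + Ψ t x)
        = fun t x => TTPotential.pd k (Φ t) x + TTPotential.pd k (Ψ t) x := by
      funext t
      exact pd_add (hΦ.contDiff hh t) (hΨ.contDiff hh t) k
    rw [e]
    exact .add _ _ h1 h2

theorem Tail.exists_bound {h : TensorField} (hh : IsTT h) {σ C : ℝ} (hσ : -5 < σ) (hσ0 : σ ≤ 0)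
    (hC : ∀ z i j, z ≠ 0 → |h z i j| ≤ C * ‖z‖ ^ σ) {n : ℕ} {Φ : ℝ → E3 → ℝ} (hΦ : Tail h n Φ)
    (R : ℝ) : ∃ K, ∀ t x, ‖x‖ ≤ R → |Φ t x| ≤ (Ioi (2 : ℝ)).indicator (fun t => K * t ^ (n + σ)) t := by
  induction hΦ with
  | base g hg i j w hw hw0 D hD =>
    obtain ⟨K, hK0, hK⟩ := hh.exists_avg_le hσ hσ0 hC hg i j R
    refine ⟨D * K, fun t x hx => ?_⟩
    by_cases ht : t ≤ 2
    · simp [hw0 t ht, indicator_of_notMem (show t ∉ Ioi (2 : ℝ) from not_lt.2 ht)]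
    · have ht2 := not_le.1 ht
      rw [indicator_of_mem (show t ∈ Ioi (2 : ℝ) from ht2), abs_mul, Real.rpow_add (by linarith),
        Real.rpow_natCast]
      calc |w t| * _ ≤ D * t ^ n * (K * t ^ σ) := mul_le_mul (hD t ht2) (hK t x ht2.le hx)
            (abs_nonneg _) ((abs_nonneg _).trans (hD t ht2))
        _ = _ := by ring
  | add Φ Ψ _ _ h1 h2 =>
    obtain ⟨K1, hK1⟩ := h1
    obtain ⟨K2, hK2⟩ := h2
    refine ⟨K1 + K2, fun t x hx => (abs_add_le _ _).trans ((add_le_add (hK1 t x hx)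
      (hK2 t x hx)).trans_eq ?_)⟩
    by_cases ht : t ∈ Ioi (2 : ℝ)
    · simp only [indicator_of_mem ht]
      ring
    · simp [indicator_of_notMem ht]

/-- Derivatives of every order obey a bound by the same power t^(n+σ), which is integrable at
infinity. -/
theorem isDominatedClass_tail {h : TensorField} (hh : IsTT h) {σ C : ℝ} (hσ : -5 < σ)
    (hC : ∀ z i j, z ≠ 0 → |h z i j| ≤ C * ‖z‖ ^ σ) {n : ℕ} (hn : n + σ < -1) :
    IsDominatedClass volume {Φ | Tail h n Φ} := by
  have hσ0 : σ ≤ 0 := by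
    have : (0 : ℝ) ≤ n := Nat.cast_nonneg n
    linarith
  refine ⟨fun Φ hΦ t => hΦ.contDiff hh.contDiff t, fun Φ hΦ v => ?_,
    fun Φ hΦ x => (hΦ.measurable hh.contDiff x).aestronglyMeasurable, fun Φ hΦ x₀ => ?_⟩
  · simp only [fderiv_apply_eq_sum_pd]
    exact Tail.sum fun i => (hΦ.pd hh.contDiff i).const_mul (v i)
  · obtain ⟨K, hK⟩ := hΦ.exists_bound hh hσ hσ0 hC (‖x₀‖ + 1)
    refine ⟨1, one_pos, _, ?_, .of_forall fun t x hx => hK t x ?_⟩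
    · exact (integrable_indicator_iff measurableSet_Ioi).2
        ((integrableOn_Ioi_rpow_of_lt hn (by norm_num)).const_mul K)
    · have h1 := mem_ball_iff_norm.1 hx
      have h2 := norm_le_norm_add_norm_sub' x x₀
      linarith

end TTPotential
end

noncomputable section

namespace TTPotential

open MeasureTheory Metric Set Filter

/-! ### Averaged potentials -/

/-- A smooth bump function supported in the unit ball, with integral one. -/
def bump : E3 → ℝ :=
  ContDiffBump.normed (⟨1 / 2, 1, by norm_num, by norm_num⟩ : ContDiffBump (0 : E3)) volume

theorem contDiff_bump : ContDiff ℝ ∞ bump := ContDiffBump.contDiff_normed _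

theorem integral_bump : ∫ y, bump y = 1 := ContDiffBump.integral_normed _

theorem bump_nonneg (y : E3) : 0 ≤ bump y := ContDiffBump.nonneg_normed _ y

theorem bump_eq_zero {y : E3} (hy : y ∉ closedBall (0 : E3) 1) : bump y = 0 := by
  by_contra h
  have h1 : y ∈ Function.support bump := h
  rw [bump, ContDiffBump.support_normed_eq] at h1
  exact hy (ball_subset_closedBall h1)

theorem integrable_bump : Integrable bump :=
  contDiff_bump.continuous.integrable_of_hasCompactSupport
    (HasCompactSupport.intro (isCompact_closedBall 0 1) fun _ => bump_eq_zero)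

theorem isDominatedClass_bump (E : Type*) [NormedAddCommGroup E] [NormedSpace ℝ E]
    [FiniteDimensional ℝ E] : IsDominatedClass volume (weighted E bump) :=
  isDominatedClass_weighted integrable_bump (isCompact_closedBall 0 1) fun _ => bump_eq_zero

theorem isTest_bump : IsTest fun _ y => bump y where
  smooth := contDiff_bump.comp contDiff_snd
  supp _ _ := bump_eq_zero

/-- The average over the base point of the integrand of the potential. -/
def avgField (h : TensorField) (t : ℝ) : TensorField := fun x j l =>
  ∫ y, bump y * cubicField h t y x j l

section AvgField

variable {h : TensorField}

theorem contDiff_avgField (hh : ∀ i j, ContDiff ℝ ∞ fun x => h x i j) (j l : Fin 3) :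
    ContDiff ℝ ∞ fun p : ℝ × E3 => avgField h p.1 p.2 j l :=
  ((isDominatedClass_bump (ℝ × E3)).contDiff_integral
    (Φ := fun y p => bump y * cubicField h p.1 y p.2 j l)
    ⟨_, (contDiff_cubicField_prod hh j l).comp ((contDiff_fst.comp contDiff_snd).prodMk
      ((contDiff_snd.comp contDiff_snd).prodMk contDiff_fst)), rfl⟩).1

theorem avgField_mem (hh : ∀ i j, ContDiff ℝ ∞ fun x => h x i j) (t : ℝ) (j l : Fin 3) :
    (fun y x => bump y * cubicField h t y x j l) ∈ weighted E3 bump :=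
  ⟨_, (contDiff_cubicField_prod hh j l).comp (contDiff_const.prodMk
    (contDiff_snd.prodMk contDiff_fst)), rfl⟩

theorem P_avgField (hh : IsTT h) (t : ℝ) (x : E3) (m l : Fin 3) :
    P (avgField h t) x m l
      = ∫ y, bump y * (1 / 2 * shift3 y (fun x => h x m l) (dil t x y)) := by
  have := (P_integral (isDominatedClass_bump E3)
    (Φ := fun y x j l => bump y * cubicField h t y x j l) (avgField_mem hh.contDiff t)).2 x m l
  simp only [P_const_mul (fun i j => contDiff_cubicField hh.contDiff _ _ i j),
    P_cubicField hh] at this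
  exact this

theorem avgField_symm (t : ℝ) (x : E3) (i j : Fin 3) : avgField h t x i j = avgField h t x j i := by
  simp only [avgField, cubicField, aCubic_symm _ _ i j]

theorem avgField_traceless (hh : IsTT h) (t : ℝ) (x : E3) : ∑ i, avgField h t x i i = 0 := by
  simp only [avgField]
  rw [← integral_finsetSum _ fun i _ =>
    (isDominatedClass_bump E3).integrable (avgField_mem hh.contDiff t i i) x]
  simp only [← Finset.mul_sum, cubicField, aCubic_traceless _ (hh.symm _), mul_zero, integral_zero]

/-- The polynomial coefficients of the components of h, multiplied by the bump function, are test
functions. -/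
theorem tail_avgField (hh : ∀ i j, ContDiff ℝ ∞ fun x => h x i j) {n : ℕ} {w : ℝ → ℝ}
    (hw : Measurable w) (hw0 : ∀ t, t ≤ 2 → w t = 0) {C : ℝ}
    (hC : ∀ t, 2 < t → |w t| ≤ C * t ^ n) (j l : Fin 3) :
    Tail h n fun t x => w t * avgField h t x j l := by
  let g : Fin 3 × Fin 3 → E3 → E3 → ℝ := fun p x y =>
    1 / 2 * aCubic (fun i => x i - y i) (fun a b => if p = (a, b) then 1 else 0) j l * bump y
  have hk : ∀ p : Fin 3 × Fin 3, ContDiff ℝ ∞ fun q : E3 × E3 =>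
      aCubic (fun i => q.1 i - q.2 i) (fun a b => if p = (a, b) then 1 else 0) j l := fun p =>
    contDiff_aCubic (X := fun q : E3 × E3 => fun i => q.1 i - q.2 i)
      (H := fun _ a b => if p = (a, b) then 1 else 0)
      (fun i => ((contDiff_coord i).comp contDiff_fst).sub ((contDiff_coord i).comp contDiff_snd))
      (fun _ _ => contDiff_const) j l
  have hg : ∀ p, IsTest (g p) := fun p => isTest_bump.mul (contDiff_const.mul (hk p))
  have e : (fun t x => w t * avgField h t x j l)
      = fun t x => ∑ a, ∑ b, w t * avg (g (a, b)) (fun z => h z a b) t x := by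
    funext t x
    have h1 : ∀ y, bump y * cubicField h t y x j l
        = ∑ p : Fin 3 × Fin 3, g p x y * h (dil t x y) p.1 p.2 := by
      intro y
      rw [cubicField, aCubic_eq_sum, Finset.mul_sum, Finset.mul_sum]
      exact Finset.sum_congr rfl fun p _ => by simp only [g]; ring
    simp only [avgField, h1]
    rw [integral_finsetSum _ fun p _ => (hg p).integrable_mul
      (f := fun y => h (dil t x y) p.1 p.2)
      ((hh p.1 p.2).continuous.comp (continuous_dil_base t x)) x, Fintype.sum_prod_type,
      Finset.mul_sum]
    simp only [Finset.mul_sum, avg]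
  rw [e]
  exact Tail.sum fun a => Tail.sum fun b => .base _ (hg _) a b w hw hw0 C hC

end AvgField

/-! ### Primitives of the averaged fields -/

section Primitive

variable {f : E3 → ℝ}

theorem contDiff_shift_prod {G : E3 → E3 → ℝ} (hG : ContDiff ℝ ∞ fun p : E3 × E3 => G p.1 p.2)
    (c : ℝ) : ContDiff ℝ ∞ fun p : E3 × E3 => shift p.1 c (G p.1) p.2 :=
  (ContDiff.sum fun n _ => (((contDiff_coord n).comp contDiff_snd).sub
    ((contDiff_coord n).comp contDiff_fst)).mul (contDiff_partial_fderiv hG _)).add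
      (contDiff_const.mul hG)

/-- The primitive of the averaged integrand, for a quadratic weight. -/
def primitive (f : E3 → ℝ) (a b c : ℝ) (x : E3) (t : ℝ) (y : E3) : ℝ :=
  1 / 2 * ((a + b * t + c * t ^ 2) * (t ^ 2 * shift y 3 (shift y 4 f) (dil t x y))
    - (b + 2 * c * t) * (t ^ 3 * shift y 4 f (dil t x y)) + 2 * c * (t ^ 4 * f (dil t x y)))

theorem contDiff_dil_base_prod (x : E3) :
    ContDiff ℝ ∞ fun p : E3 × ℝ => (p.1, dil p.2 x p.1) := by
  unfold dil
  fun_prop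

theorem contDiff_shift4_prod (hf : ContDiff ℝ ∞ f) :
    ContDiff ℝ ∞ fun p : E3 × E3 => shift p.1 4 f p.2 :=
  contDiff_shift_prod (G := fun _ => f) (hf.comp contDiff_snd) 4

theorem contDiff_shift34_prod (hf : ContDiff ℝ ∞ f) :
    ContDiff ℝ ∞ fun p : E3 × E3 => shift p.1 3 (shift p.1 4 f) p.2 :=
  contDiff_shift_prod (G := fun y => shift y 4 f) (contDiff_shift4_prod hf) 3

theorem contDiff_shift3_prod (hf : ContDiff ℝ ∞ f) :
    ContDiff ℝ ∞ fun p : E3 × E3 => shift3 p.1 f p.2 :=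
  contDiff_shift_prod (G := fun y => shift y 3 (shift y 4 f)) (contDiff_shift34_prod hf) 2

theorem hasDerivAt_integral_primitive (hf : ContDiff ℝ ∞ f) (a b c : ℝ) (x : E3) (t : ℝ) :
    HasDerivAt (fun t => ∫ y, bump y * primitive f a b c x t y)
      ((a + b * t + c * t ^ 2) * t * ∫ y, bump y * (1 / 2 * shift3 y f (dil t x y))) t := by
  have hs : ContDiff ℝ ∞ fun p : E3 × ℝ => primitive f a b c x p.2 p.1 := by
    have h3 := (contDiff_shift34_prod hf).comp (contDiff_dil_base_prod x)
    have h4 := (contDiff_shift4_prod hf).comp (contDiff_dil_base_prod x)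
    have h0 := (hf.comp contDiff_snd).comp (contDiff_dil_base_prod x)
    simp only [Function.comp_def] at h3 h4 h0
    have hq : ∀ a b c : ℝ, ContDiff ℝ ∞ fun p : E3 × ℝ => a + b * p.2 + c * p.2 ^ 2 := by
      intro a b c
      fun_prop
    have hm : ∀ n : ℕ, ContDiff ℝ ∞ fun p : E3 × ℝ => p.2 ^ n := fun n => contDiff_snd.pow n
    have hl : ContDiff ℝ ∞ fun p : E3 × ℝ => b + 2 * c * p.2 := by fun_prop
    exact contDiff_const.mul ((((hq a b c).mul ((hm 2).mul h3)).sub (hl.mul ((hm 3).mul h4))).add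
      (contDiff_const.mul ((hm 4).mul h0)))
  have hmem : (fun (y : E3) (t : ℝ) => bump y * primitive f a b c x t y) ∈ weighted ℝ bump :=
    ⟨_, hs, rfl⟩
  obtain ⟨h1, h2⟩ := (isDominatedClass_bump ℝ).contDiff_integral hmem
  have h3 := (differentiable_of_contDiff h1 t).hasDerivAt
  refine h3.congr_deriv ?_
  rw [← fderiv_apply_one_eq_deriv, h2, ← integral_const_mul]
  congr 1
  funext y
  have h4 : HasDerivAt (fun t => bump y * primitive f a b c x t y) _ t :=
    (hasDerivAt_primitive hf x y a b c t).const_mul (bump y)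
  rw [fderiv_apply_one_eq_deriv, h4.deriv]
  ring

theorem continuous_integral_shift3 (hf : ContDiff ℝ ∞ f) (x : E3) :
    Continuous fun t => ∫ y, bump y * (1 / 2 * shift3 y f (dil t x y)) := by
  refine ((isDominatedClass_bump ℝ).contDiff_integral
    (Φ := fun y t => bump y * (1 / 2 * shift3 y f (dil t x y))) ⟨_, ?_, rfl⟩).1.continuous
  exact contDiff_const.mul ((contDiff_shift3_prod hf).comp (contDiff_dil_base_prod x))

theorem integral_primitive_zero (a b c : ℝ) (x : E3) :
    ∫ y, bump y * primitive f a b c x 0 y = 0 := by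
  simp [primitive]

/-- At t = 1 the dilated point is x for every base point, and the bump function has mass one. -/
theorem integral_unitWeight_mul_shift3 (hf : ContDiff ℝ ∞ f) (x : E3) :
    ∫ t, unitWeight t * ∫ y, bump y * (1 / 2 * shift3 y f (dil t x y)) = f x := by
  rw [integral_unitWeight_mul]
  have hderiv := hasDerivAt_integral_primitive hf 1 (-2) 1 x
  have hcont := continuous_integral_shift3 hf x
  rw [intervalIntegral.integral_congr (g := fun t => (1 + (-2) * t + 1 * t ^ 2) * t
    * ∫ y, bump y * (1 / 2 * shift3 y f (dil t x y))) fun t _ => by ring]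
  rw [intervalIntegral.integral_eq_sub_of_hasDerivAt (fun t _ => hderiv t)
    (Continuous.intervalIntegrable (by fun_prop) _ _), integral_primitive_zero, sub_zero]
  have : ∀ y, bump y * primitive f 1 (-2) 1 x 1 y = bump y * f x := by
    intro y
    simp only [primitive, dil, one_smul, add_sub_cancel]
    ring
  simp only [this, integral_mul_const, integral_bump, one_mul]

theorem shift_dil (y : E3) (t c : ℝ) (f : E3 → ℝ) (x : E3) :
    shift y c f (dil t x y) = t * ∑ n, (x n - y n) * pd n f (dil t x y) + c * f (dil t x y) := by
  simp only [shift, dil_sub_apply, Finset.mul_sum, mul_assoc]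

/-- The product (E+3)(E+4) is E² + 7E + 12, and E² is the pure second-order part plus E. In this
form each power of t accompanies as many derivatives of f, ready for integration by parts in the
base point. -/
theorem shift_shift_dil (hf : ContDiff ℝ ∞ f) (y : E3) (t : ℝ) (x : E3) :
    shift y 3 (shift y 4 f) (dil t x y)
      = t ^ 2 * ∑ n, ∑ k, (x n - y n) * (x k - y k) * pd n (pd k f) (dil t x y)
        + 8 * (t * ∑ n, (x n - y n) * pd n f (dil t x y)) + 12 * f (dil t x y) := by
  have hX : ∀ i, ContDiff ℝ ∞ fun x : E3 => x i - y i :=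
    fun i => (contDiff_coord i).sub contDiff_const
  let X : Fin 3 → smoothAlg := fun i => ⟨_, hX i⟩
  have hXd : ∀ i j, pdD i (X j) = if i = j then 1 else 0 := by
    intro i j
    refine Subtype.ext ((pd_coord i j (y j)).trans ?_)
    split_ifs <;> rfl
  let F : smoothAlg := ⟨f, hf⟩
  let G : smoothAlg := ∑ k, X k * pdD k F + algebraMap ℝ smoothAlg 4 * F
  have hG : G.1 = shift y 4 f := by
    funext z
    simp only [G, shift, Fin.sum_univ_three]
    rfl
  have hd : ∀ n, pdD n G = ∑ k, X k * pdD n (pdD k F) + 5 * pdD n F := by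
    intro n
    have h4 : (algebraMap ℝ smoothAlg) 4 = 4 := map_ofNat _ 4
    have d4 : pdD n 4 = 0 := (pdD n).map_natCast 4
    simp only [G, map_add, map_sum, Derivation.leibniz, hXd, smul_eq_mul, h4, d4,
      Finset.sum_add_distrib, mul_ite, mul_one, mul_zero, Finset.sum_ite_eq, Finset.mem_univ,
      if_true, add_zero]
    ring
  have hd' : ∀ n z, pd n (shift y 4 f) z
      = ∑ k, (z k - y k) * pd n (pd k f) z + 5 * pd n f z := by
    intro n z
    have := congrFun (congrArg Subtype.val (hd n)) z
    rw [pdD_coe, hG] at this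
    simp only [Fin.sum_univ_three] at this ⊢
    exact this
  rw [shift]
  simp only [hd', shift_dil, dil_sub_apply, Fin.sum_univ_three]
  ring

/-- The function `x ↦ x_n - y_n` times a test function. -/
theorem IsTest.coord_mul {g : E3 → E3 → ℝ} (hg : IsTest g) (n : Fin 3) :
    IsTest fun x y => (x n - y n) * g x y :=
  hg.mul (((contDiff_coord n).comp contDiff_fst).sub ((contDiff_coord n).comp contDiff_snd))

/-- Functions of `t` which are `O(t ^ σ)` on `[2, ∞)`. -/
def Decays (σ : ℝ) (F : ℝ → ℝ) : Prop := ∃ K, ∀ t, 2 ≤ t → |F t| ≤ K * t ^ σ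

theorem Decays.add {σ : ℝ} {F G : ℝ → ℝ} (hF : Decays σ F) (hG : Decays σ G) :
    Decays σ fun t => F t + G t := by
  obtain ⟨K, hK⟩ := hF
  obtain ⟨L, hL⟩ := hG
  refine ⟨K + L, fun t ht => (abs_add_le _ _).trans ?_⟩
  rw [add_mul]
  exact add_le_add (hK t ht) (hL t ht)

theorem Decays.sum {σ : ℝ} {F : Fin 3 → ℝ → ℝ} (hF : ∀ i, Decays σ (F i)) :
    Decays σ fun t => ∑ i, F i t := by
  simp only [Fin.sum_univ_three]
  exact ((hF 0).add (hF 1)).add (hF 2)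

theorem Decays.bdd_mul {σ : ℝ} {F w : ℝ → ℝ} (hF : Decays σ F) {D ρ : ℝ}
    (hw : ∀ t, 2 ≤ t → |w t| ≤ D * t ^ ρ) : Decays (ρ + σ) fun t => w t * F t := by
  obtain ⟨K, hK⟩ := hF
  refine ⟨D * K, fun t ht => ?_⟩
  rw [abs_mul, Real.rpow_add (by linarith)]
  calc |w t| * |F t| ≤ D * t ^ ρ * (K * t ^ σ) :=
        mul_le_mul (hw t ht) (hK t ht) (abs_nonneg _) ((abs_nonneg _).trans (hw t ht))
    _ = _ := by ring

theorem Decays.const_mul {σ : ℝ} {F : ℝ → ℝ} (hF : Decays σ F) (c : ℝ) :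
    Decays σ fun t => c * F t := by
  have := hF.bdd_mul (w := fun _ => c) (D := |c|) (ρ := 0) (by simp)
  rwa [zero_add] at this

theorem Decays.congr {σ : ℝ} {F G : ℝ → ℝ} (hF : Decays σ F) (h : ∀ t, 2 ≤ t → G t = F t) :
    Decays σ G := by
  obtain ⟨K, hK⟩ := hF
  exact ⟨K, fun t ht => by rw [h t ht]; exact hK t ht⟩

theorem Decays.tendsto {σ : ℝ} (hσ : σ < 0) {F : ℝ → ℝ} (hF : Decays σ F) :
    Tendsto F atTop (nhds 0) := by
  obtain ⟨K, hK⟩ := hF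
  have h1 : Tendsto (fun t : ℝ => K * t ^ σ) atTop (nhds 0) := by
    have := (tendsto_rpow_neg_atTop (neg_pos.2 hσ)).const_mul K
    simpa using this
  refine squeeze_zero_norm' ?_ h1
  filter_upwards [eventually_ge_atTop 2] with t ht using hK t ht

variable {σ : ℝ}

theorem decays_ratio_mul {F : ℝ → ℝ} (hF : Decays σ F) : Decays σ fun t => t / (t - 1) * F t := by
  have := hF.bdd_mul (w := fun t => t / (t - 1)) (D := 2) (ρ := 0) fun t ht => by
    have ht1 : 0 < t - 1 := by linarith
    rw [Real.rpow_zero, mul_one, abs_of_nonneg (by positivity), div_le_iff₀ ht1]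
    linarith
  rwa [zero_add] at this

/-- The factor t meets the (t - 1)⁻¹ gained by integrating by parts, so the rate σ is preserved
without decay of the derivatives of f. -/
theorem decays_avg_shift (hf : ContDiff ℝ ∞ f)
    (hd : ∀ g, IsTest g → ∀ x, Decays σ fun t => avg g f t x) (x : E3) :
    Decays σ fun t => t * ∑ n, ∫ y, bump y * ((x n - y n) * pd n f (dil t x y)) := by
  have hg := fun n => isTest_bump.coord_mul n
  refine (Decays.sum fun n => decays_ratio_mul (hd _ ((hg n).pdY n) x)).congr fun t ht => ?_
  rw [Finset.mul_sum]
  refine Finset.sum_congr rfl fun n _ => ?_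
  have h1 := avg_pd (hg n) hf (t := t) (by linarith) x n
  have h2 : ∫ y, bump y * ((x n - y n) * pd n f (dil t x y))
      = avg (fun x y => (x n - y n) * bump y) (pd n f) t x := by
    rw [avg]
    congr 1
    funext y
    ring
  rw [h2, h1]
  ring

theorem decays_avg_shift_shift (hf : ContDiff ℝ ∞ f)
    (hd : ∀ g, IsTest g → ∀ x, Decays σ fun t => avg g f t x) (x : E3) :
    Decays σ fun t => t ^ 2 * ∑ n, ∑ k,
      ∫ y, bump y * ((x n - y n) * (x k - y k) * pd n (pd k f) (dil t x y)) := by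
  have hg := fun n k => (isTest_bump.coord_mul k).coord_mul n
  refine (Decays.sum fun n => Decays.sum fun k => decays_ratio_mul (decays_ratio_mul
    (hd _ (((hg n k).pdY n).pdY k) x))).congr fun t ht => ?_
  rw [Finset.mul_sum]
  refine Finset.sum_congr rfl fun n _ => ?_
  rw [Finset.mul_sum]
  refine Finset.sum_congr rfl fun k _ => ?_
  have h1 := avg_pd (hg n k) (contDiff_pd hf k) (t := t) (by linarith) x n
  have h3 := avg_pd ((hg n k).pdY n) hf (t := t) (by linarith) x k
  have h2 : ∫ y, bump y * ((x n - y n) * (x k - y k) * pd n (pd k f) (dil t x y))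
      = avg (fun x y => (x n - y n) * ((x k - y k) * bump y)) (pd n (pd k f)) t x := by
    rw [avg]
    congr 1
    funext y
    ring
  rw [h2, h1, h3]
  ring

/-- The averaged primitive tends to zero at infinity. -/
theorem tendsto_integral_primitive (hf : ContDiff ℝ ∞ f)
    (hd : ∀ g, IsTest g → ∀ x, Decays σ fun t => avg g f t x) {a b c D ρ : ℝ}
    (h1 : ∀ t, 2 ≤ t → |(a + b * t + c * t ^ 2) * t ^ 2| ≤ D * t ^ ρ)
    (h2 : ∀ t, 2 ≤ t → |(b + 2 * c * t) * t ^ 3| ≤ D * t ^ ρ)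
    (h3 : ∀ t, 2 ≤ t → |2 * c * t ^ 4| ≤ D * t ^ ρ) (hρ : ρ + σ < 0) (x : E3) :
    Tendsto (fun t => ∫ y, bump y * primitive f a b c x t y) atTop (nhds 0) := by
  have hpdc := fun n t => (contDiff_pd hf n).continuous.comp (continuous_dil_base t x)
  have hpdc2 := fun n k t =>
    (contDiff_pd (contDiff_pd hf k) n).continuous.comp (continuous_dil_base t x)
  simp only [Function.comp_def] at hpdc hpdc2
  have hco : ∀ n, Continuous fun y : E3 => x n - y n := fun n =>
    continuous_const.sub (contDiff_coord n).continuous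
  have hI1 : ∀ t n, Integrable fun y => bump y * ((x n - y n) * pd n f (dil t x y)) := fun t n =>
    isTest_bump.integrable_mul (f := fun y => (x n - y n) * pd n f (dil t x y))
      ((hco n).mul (hpdc n t)) x
  have hI2 : ∀ t n k, Integrable fun y =>
      bump y * ((x n - y n) * (x k - y k) * pd n (pd k f) (dil t x y)) := fun t n k =>
    isTest_bump.integrable_mul (f := fun y => (x n - y n) * (x k - y k) * pd n (pd k f) (dil t x y))
      (((hco n).mul (hco k)).mul (hpdc2 n k t)) x
  have hI0 : ∀ t, Integrable fun y => bump y * f (dil t x y) := fun t =>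
    isTest_bump.integrable_mul (hf.continuous.comp (continuous_dil_base t x)) x
  have hA0 := hd _ isTest_bump x
  have hA1 := decays_avg_shift hf hd x
  have hA2 := decays_avg_shift_shift hf hd x
  have e4 : ∀ t, ∫ y, bump y * shift y 4 f (dil t x y)
      = t * ∑ n, (∫ y, bump y * ((x n - y n) * pd n f (dil t x y)))
        + 4 * avg (fun _ y => bump y) f t x := by
    intro t
    rw [← integral_finsetSum _ fun n _ => hI1 t n, ← integral_const_mul, avg, ← integral_const_mul,
      ← integral_add ((integrable_finsetSum _ fun n _ => hI1 t n).const_mul t)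
        ((hI0 t).const_mul 4)]
    congr 1
    funext y
    rw [shift_dil, ← Finset.mul_sum]
    ring
  have e3 : ∀ t, ∫ y, bump y * shift y 3 (shift y 4 f) (dil t x y)
      = t ^ 2 * ∑ n, ∑ k,
          (∫ y, bump y * ((x n - y n) * (x k - y k) * pd n (pd k f) (dil t x y)))
        + 8 * (t * ∑ n, (∫ y, bump y * ((x n - y n) * pd n f (dil t x y))))
        + 12 * avg (fun _ y => bump y) f t x := by
    intro t
    have hS : ∀ n, Integrable fun y => ∑ k,
        bump y * ((x n - y n) * (x k - y k) * pd n (pd k f) (dil t x y)) :=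
      fun n => integrable_finsetSum _ fun k _ => hI2 t n k
    simp only [← integral_finsetSum _ fun k _ => hI2 t _ k]
    rw [← integral_finsetSum _ fun n _ => hI1 t n, ← integral_finsetSum _ fun n _ => hS n, avg,
      ← integral_const_mul, ← integral_const_mul, ← integral_const_mul, ← integral_const_mul,
      ← integral_add' ((integrable_finsetSum _ fun n _ => hS n).const_mul _)
        (((integrable_finsetSum _ fun n _ => hI1 t n).const_mul t).const_mul 8),
      ← integral_add' (((integrable_finsetSum _ fun n _ => hS n).const_mul _).add
        (((integrable_finsetSum _ fun n _ => hI1 t n).const_mul t).const_mul 8))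
        ((hI0 t).const_mul 12)]
    congr 1
    funext y
    simp only [shift_shift_dil hf, ← Finset.mul_sum, Pi.add_apply]
    ring
  have d4 : Decays σ fun t => ∫ y, bump y * shift y 4 f (dil t x y) := by
    simp only [e4]
    exact hA1.add (hA0.const_mul 4)
  have d3 : Decays σ fun t => ∫ y, bump y * shift y 3 (shift y 4 f) (dil t x y) := by
    simp only [e3]
    exact (hA2.add (hA1.const_mul 8)).add (hA0.const_mul 12)
  have hc4 : ∀ t, Integrable fun y => bump y * shift y 4 f (dil t x y) := fun t =>
    isTest_bump.integrable_mul (f := fun y => shift y 4 f (dil t x y))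
      ((contDiff_shift4_prod hf).continuous.comp
        (continuous_id.prodMk (continuous_dil_base t x))) x
  have hc3 : ∀ t, Integrable fun y => bump y * shift y 3 (shift y 4 f) (dil t x y) := fun t =>
    isTest_bump.integrable_mul (f := fun y => shift y 3 (shift y 4 f) (dil t x y))
      ((contDiff_shift34_prod hf).continuous.comp
        (continuous_id.prodMk (continuous_dil_base t x))) x
  -- The averaged primitive is a combination of three averages of rate σ, with coefficients of size
  -- t^ρ.
  have main : ∀ t, ∫ y, bump y * primitive f a b c x t y
      = 1 / 2 * ((a + b * t + c * t ^ 2) * t ^ 2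
          * (∫ y, bump y * shift y 3 (shift y 4 f) (dil t x y))
        + (-1) * ((b + 2 * c * t) * t ^ 3 * ∫ y, bump y * shift y 4 f (dil t x y))
        + 2 * c * t ^ 4 * avg (fun _ y => bump y) f t x) := by
    intro t
    rw [avg, ← integral_const_mul, ← integral_const_mul, ← integral_const_mul,
      ← integral_const_mul, ← integral_add' ((hc3 t).const_mul _)
        (((hc4 t).const_mul _).const_mul _),
      ← integral_add' (((hc3 t).const_mul _).add (((hc4 t).const_mul _).const_mul _))
        ((hI0 t).const_mul _), ← integral_const_mul]
    congr 1
    funext y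
    simp only [primitive, Pi.add_apply]
    ring
  simp only [main]
  exact ((((d3.bdd_mul h1).add ((d4.bdd_mul h2).const_mul (-1))).add
    (hA0.bdd_mul h3)).const_mul (1 / 2)).tendsto hρ

end Primitive

end TTPotential
end

noncomputable section

namespace TTPotential

open MeasureTheory Metric Set Filter

/-! ### Modified potentials -/

section Modified

variable {h : TensorField} {σ C a b c : ℝ} {n : ℕ}

/-- The quadratic polynomial `a + b t + c t²`, multiplied by `t`, grows at most like `t ^ n`, in the
strong sense that this also holds for its derivatives. -/
def QuadGrowth (a b c : ℝ) (n : ℕ) : Prop :=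
  ∃ D, ∀ t, 1 ≤ t → |(a + b * t + c * t ^ 2) * t| ≤ D * t ^ n ∧
    |(b + 2 * c * t) * t ^ 2| ≤ D * t ^ n ∧ |2 * c * t ^ 3| ≤ D * t ^ n

/-- The weight of the potential, modified by a multiple of the given quadratic polynomial. -/
def modifiedWeight (a b c t : ℝ) : ℝ :=
  unitWeight t - (Ioi (0 : ℝ)).indicator (fun t => (a + b * t + c * t ^ 2) * t) t

/-- The averaged potential with modified weight. -/
def modifiedPotential (h : TensorField) (a b c : ℝ) : TensorField := fun x j l =>
  ∫ t, modifiedWeight a b c t * avgField h t x j l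

/-- The weight is split at t = 2: the first part has compact support and needs no decay, the second
is a `Tail`. -/
theorem exists_isDominatedClass_modified (hh : IsTT h) (hσ : -5 < σ)
    (hC : ∀ z i j, z ≠ 0 → |h z i j| ≤ C * ‖z‖ ^ σ) (hn : n + σ < -1) (hq : QuadGrowth a b c n) :
    ∃ S : Set (ℝ → E3 → ℝ), IsDominatedClass volume S ∧
      ∀ i j, (fun t x => modifiedWeight a b c t * avgField h t x i j) ∈ S := by
  set q : ℝ → ℝ := fun t => (a + b * t + c * t ^ 2) * t with hqdef
  have hqc : Continuous q := by fun_prop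
  obtain ⟨D, hD⟩ := hq
  have hw1 : IsDominatedClass volume
      (weighted E3 fun t => unitWeight t - (Ioc (0 : ℝ) 2).indicator q t) := by
    refine isDominatedClass_weighted (K := Icc 0 2) (integrable_unitWeight.sub ?_) isCompact_Icc ?_
    · exact (integrable_indicator_iff measurableSet_Ioc).2
        (hqc.integrableOn_Icc.mono_set Ioc_subset_Icc_self)
    · intro t ht
      rw [unitWeight_eq_zero fun h' => ht ⟨h'.1, h'.2.trans one_le_two⟩,
        indicator_of_notMem fun h' => ht (Ioc_subset_Icc_self h'), sub_zero]
  refine ⟨_, hw1.add (isDominatedClass_tail hh hσ hC hn), fun i j => ⟨_,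
    ⟨fun t x => avgField h t x i j, contDiff_avgField hh.contDiff i j, rfl⟩, _,
    tail_avgField hh.contDiff (w := fun t => -(Ioi (2 : ℝ)).indicator q t) (C := D)
      (hqc.measurable.indicator measurableSet_Ioi).neg (fun t ht => ?_) (fun t ht => ?_) i j, ?_⟩⟩
  · rw [indicator_of_notMem (notMem_Ioi.2 ht), neg_zero]
  · rw [indicator_of_mem (mem_Ioi.2 ht), abs_neg]
    exact (hD t (one_le_two.trans ht.le)).1
  · funext t x
    have : modifiedWeight a b c t = unitWeight t - (Ioc (0 : ℝ) 2).indicator q t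
        + -(Ioi (2 : ℝ)).indicator q t := by
      rw [modifiedWeight, ← hqdef, ← Ioc_union_Ioi_eq_Ioi (zero_le_two (α := ℝ)),
        indicator_union_of_disjoint (Set.Ioc_disjoint_Ioi le_rfl)]
      ring
    rw [this, add_mul]

/-- The integrand is an exact derivative. Its primitive vanishes at 0 through the powers of t, and
at infinity because it is O(t^(n+1+σ)) with negative exponent. -/
theorem integral_Ioi_quad_mul_eq_zero (hh : IsTT h) (hσ : -5 < σ)
    (hC : ∀ z i j, z ≠ 0 → |h z i j| ≤ C * ‖z‖ ^ σ) (hn : n + σ < -1) (hq : QuadGrowth a b c n)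
    (x : E3) (m l : Fin 3)
    (hint : IntegrableOn (fun t => (a + b * t + c * t ^ 2) * t *
      ∫ y, bump y * (1 / 2 * shift3 y (fun x => h x m l) (dil t x y))) (Ioi 0)) :
    ∫ t in Ioi (0 : ℝ), (a + b * t + c * t ^ 2) * t *
      ∫ y, bump y * (1 / 2 * shift3 y (fun x => h x m l) (dil t x y)) = 0 := by
  have hf := hh.contDiff m l
  have hσ0 : σ ≤ 0 := by
    have : (0 : ℝ) ≤ n := Nat.cast_nonneg n
    linarith
  obtain ⟨D, hD⟩ := hq
  have hder := hasDerivAt_integral_primitive hf a b c x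
  have hpow : ∀ t : ℝ, 2 ≤ t → t ^ ((n : ℝ) + 1) = t ^ n * t := fun t ht => by
    rw [Real.rpow_add_one (by linarith), Real.rpow_natCast]
  have hmul : ∀ t u : ℝ, 2 ≤ t → |u| ≤ D * t ^ n → |u * t| ≤ D * t ^ ((n : ℝ) + 1) :=
    fun t u ht hu => by
      rw [hpow t ht, ← mul_assoc, abs_mul, abs_of_pos (by linarith : 0 < t)]
      exact mul_le_mul_of_nonneg_right hu (by linarith)
  have hlim := tendsto_integral_primitive (σ := σ) (a := a) (b := b) (c := c) (D := D)
    (ρ := (n : ℝ) + 1) hf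
    (fun g hg x => by
      obtain ⟨K, -, hK⟩ := hh.exists_avg_le hσ hσ0 hC hg m l ‖x‖
      exact ⟨K, fun t ht => hK t x ht le_rfl⟩)
    (fun t ht => by
      have := hmul t _ ht (hD t (one_le_two.trans ht)).1
      convert this using 2
      ring)
    (fun t ht => by
      have := hmul t _ ht (hD t (one_le_two.trans ht)).2.1
      convert this using 2
      ring)
    (fun t ht => by
      have := hmul t _ ht (hD t (one_le_two.trans ht)).2.2
      convert this using 2
      ring) (by linarith) x
  rw [integral_Ioi_of_hasDerivAt_of_tendsto (hder 0).continuousAt.continuousWithinAt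
    (fun t _ => hder t) hint hlim, integral_primitive_zero, sub_zero]

theorem IsTT.modifiedPotential (hh : IsTT h) (hσ : -5 < σ)
    (hC : ∀ z i j, z ≠ 0 → |h z i j| ≤ C * ‖z‖ ^ σ) (hn : n + σ < -1) (hq : QuadGrowth a b c n) :
    IsSymTraceless (modifiedPotential h a b c) ∧ P (modifiedPotential h a b c) = h := by
  obtain ⟨S, hS, hmem⟩ := exists_isDominatedClass_modified hh hσ hC hn hq
  obtain ⟨hsm, hP⟩ := P_integral hS
    (Φ := fun t x i j => modifiedWeight a b c t * avgField h t x i j) hmem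
  refine ⟨⟨contDiff_pi.2 fun i => contDiff_pi.2 fun j => hsm i j, fun x i j => ?_, fun x => ?_⟩, ?_⟩
  · simp only [TTPotential.modifiedPotential, avgField_symm _ _ i j]
  · simp only [TTPotential.modifiedPotential]
    rw [← integral_finsetSum _ fun i _ => hS.integrable (hmem i i) x]
    simp only [← Finset.mul_sum, avgField_traceless hh, mul_zero, integral_zero]
  · funext x m l
    have hI := hS.integrable_P
      (Φ := fun t x i j => modifiedWeight a b c t * avgField h t x i j) hmem x m l
    have hsec : ∀ t i j, ContDiff ℝ ∞ fun x => avgField h t x i j := fun t i j =>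
      (contDiff_avgField hh.contDiff i j).comp (contDiff_const.prodMk contDiff_id)
    have hF := continuous_integral_shift3 (hh.contDiff m l) x
    have hU := integral_unitWeight_mul_shift3 (hh.contDiff m l) x
    have hZ := integral_Ioi_quad_mul_eq_zero hh hσ hC hn hq x m l
    have hPt : ∀ t, P (fun x i j => modifiedWeight a b c t * avgField h t x i j) x m l
        = modifiedWeight a b c t
          * ∫ y, bump y * (1 / 2 * shift3 y (fun x => h x m l) (dil t x y)) := fun t => by
      rw [P_const_mul (hsec t), P_avgField hh]
    refine (hP x m l).trans ((integral_congr_ae (.of_forall hPt)).trans ?_)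
    replace hI := hI.congr (.of_forall hPt)
    set F : ℝ → ℝ := fun t => ∫ y, bump y * (1 / 2 * shift3 y (fun x => h x m l) (dil t x y))
    change Integrable fun t => modifiedWeight a b c t * F t at hI
    change ∫ t, modifiedWeight a b c t * F t = _
    change ∫ t, unitWeight t * F t = _ at hU
    change IntegrableOn (fun t => (a + b * t + c * t ^ 2) * t * F t) _ →
      ∫ t in _, (a + b * t + c * t ^ 2) * t * F t = 0 at hZ
    have hUi : Integrable fun t => unitWeight t * F t := by
      have : (fun t => unitWeight t * F t)
          = (Icc (0 : ℝ) 1).indicator fun t => t * (1 - t) ^ 2 * F t :=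
        funext fun t => (indicator_mul_left _ _ _).symm
      rw [this, integrable_indicator_iff measurableSet_Icc]
      exact Continuous.integrableOn_Icc (by fun_prop)
    have hsub : ∀ t, (Ioi (0 : ℝ)).indicator (fun t => (a + b * t + c * t ^ 2) * t * F t) t
        = unitWeight t * F t - modifiedWeight a b c t * F t := fun t => by
      rw [modifiedWeight, indicator_mul_left _ (fun t => (a + b * t + c * t ^ 2) * t) F]
      ring
    -- Integrability of the polynomial part comes from writing it as a difference of two integrands
    -- already known to be integrable.
    have hqi : IntegrableOn (fun t => (a + b * t + c * t ^ 2) * t * F t) (Ioi 0) := by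
      rw [← integrable_indicator_iff measurableSet_Ioi]
      exact (hUi.sub hI).congr (.of_forall fun t => (hsub t).symm)
    have hz := hZ hqi
    rw [← integral_indicator measurableSet_Ioi, integral_congr_ae (.of_forall hsub),
      integral_sub hUi hI, hU] at hz
    linarith

end Modified

end TTPotential
end

noncomputable section

namespace TTPotential

open MeasureTheory Metric Set Filter

/-! ### Growth of the potentials -/

theorem abs_aCubic_le {X : Fin 3 → ℝ} {H : Fin 3 → Fin 3 → ℝ} {ρ M : ℝ} (hX : ∀ i, |X i| ≤ ρ)
    (hH : ∀ i j, |H i j| ≤ M) (j l : Fin 3) : |aCubic X H j l| ≤ 36 * (ρ ^ 3 * M) := by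
  have hρ : 0 ≤ ρ := (abs_nonneg _).trans (hX 0)
  have hM : 0 ≤ M := (abs_nonneg _).trans (hH 0 0)
  have hm : ∀ i a b, |X i * H a b| ≤ ρ * M := fun i a b => by
    rw [abs_mul]
    exact mul_le_mul (hX i) (hH a b) (abs_nonneg _) hρ
  have hc : ∀ a b, |X (a + 1) * H (a + 2) b - X (a + 2) * H (a + 1) b| ≤ 2 * (ρ * M) :=
    fun a b => (abs_sub _ _).trans (by linarith [hm (a + 1) (a + 2) b, hm (a + 2) (a + 1) b])
  have hs : ∀ {f : Fin 3 → ℝ} {A : ℝ}, (∀ n, |f n| ≤ A) → |∑ n, f n| ≤ 3 * A := fun hf =>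
    (Finset.abs_sum_le_sum_abs _ _).trans ((Finset.sum_le_sum fun n _ => hf n).trans_eq (by simp))
  have hv : ∀ a b, |X b * ∑ n, (X (a + 1) * H (a + 2) n - X (a + 2) * H (a + 1) n) * X n|
      ≤ ρ * (3 * (2 * (ρ * M) * ρ)) := fun a b => by
    rw [abs_mul]
    refine mul_le_mul (hX b) (hs fun n => ?_) (abs_nonneg _) hρ
    rw [abs_mul]
    exact mul_le_mul (hc a n) (hX n) (abs_nonneg _) (by positivity)
  have hn : |∑ n, X n * X n| ≤ 3 * (ρ * ρ) := hs fun n => by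
    rw [abs_mul]
    exact mul_le_mul (hX n) (hX n) (abs_nonneg _) hρ
  have hw : |(∑ n, X n * X n) * ((X (j + 1) * H (j + 2) l - X (j + 2) * H (j + 1) l)
      + (X (l + 1) * H (l + 2) j - X (l + 2) * H (l + 1) j))|
      ≤ 3 * (ρ * ρ) * (2 * (ρ * M) + 2 * (ρ * M)) := by
    rw [abs_mul]
    exact mul_le_mul hn ((abs_add_le _ _).trans (add_le_add (hc j l) (hc l j))) (abs_nonneg _)
      (by positivity)
  rw [aCubic]
  refine (abs_sub _ _).trans ?_
  rw [abs_mul, abs_two]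
  linarith [abs_add_le (X j * ∑ n, (X (l + 1) * H (l + 2) n - X (l + 2) * H (l + 1) n) * X n)
    (X l * ∑ n, (X (j + 1) * H (j + 2) n - X (j + 2) * H (j + 1) n) * X n), hv l j, hv j l]

/-- The base point displaces t x by at most |1 - t|. For t ≤ 1 the summand 1 absorbs this; for t ≥ 1
half of t‖x‖ does, which is why ‖x‖ ≥ 2 is required. -/
theorem norm_dil_ge {t : ℝ} (ht : 0 ≤ t) {x y : E3} (hx : 2 ≤ ‖x‖) (hy : ‖y‖ ≤ 1) :
    (1 + t * ‖x‖) / 2 ≤ 1 + ‖dil t x y‖ := by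
  have h1 : t * ‖x‖ ≤ ‖dil t x y‖ + |1 - t| * ‖y‖ := by
    have : t • x = dil t x y - (1 - t) • y := by
      simp only [dil]
      module
    calc t * ‖x‖ = ‖t • x‖ := by rw [norm_smul, Real.norm_of_nonneg ht]
      _ ≤ _ := by
        rw [this]
        refine (norm_sub_le _ _).trans_eq ?_
        rw [norm_smul, Real.norm_eq_abs]
  have h2 : |1 - t| * ‖y‖ ≤ |1 - t| := mul_le_of_le_one_right (abs_nonneg _) hy
  have h0 := norm_nonneg (dil t x y)
  rcases le_total t 1 with ht1 | ht1
  · rw [abs_of_nonneg (by linarith)] at h1 h2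
    linarith
  · rw [abs_of_nonpos (by linarith)] at h1 h2
    have h3 : t * 2 ≤ t * ‖x‖ := mul_le_mul_of_nonneg_left hx ht
    linarith

section Growth

variable {h : TensorField} {σ C : ℝ}

theorem abs_cubicField_le {t : ℝ} {x y : E3} {M : ℝ} (hM : ∀ i j, |h (dil t x y) i j| ≤ M)
    (hx : 2 ≤ ‖x‖) (hy : ‖y‖ ≤ 1) (j l : Fin 3) :
    |cubicField h t y x j l| ≤ 144 * (‖x‖ ^ 3 * M) := by
  have h1 : ∀ i, |x i - y i| ≤ 2 * ‖x‖ := fun i => by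
    have h2 : ‖(x - y) i‖ ≤ ‖x - y‖ := PiLp.norm_apply_le (x - y) i
    have h3 := norm_sub_le x y
    rw [Real.norm_eq_abs, PiLp.sub_apply] at h2
    linarith
  have h4 := abs_aCubic_le h1 hM j l
  rw [cubicField, abs_mul, abs_of_nonneg (by norm_num : (0 : ℝ) ≤ 1 / 2)]
  linarith [mul_pow 2 ‖x‖ 3, show (2 * ‖x‖) ^ 3 * M = 8 * (‖x‖ ^ 3 * M) by ring]

theorem abs_avgField_le {t : ℝ} {x : E3} {M : ℝ}
    (hM : ∀ y : E3, ‖y‖ ≤ 1 → ∀ i j, |h (dil t x y) i j| ≤ M) (hx : 2 ≤ ‖x‖) (j l : Fin 3) :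
    |avgField h t x j l| ≤ 144 * (‖x‖ ^ 3 * M) := by
  rw [avgField, ← one_mul (144 * _), ← integral_bump, ← integral_mul_const, ← Real.norm_eq_abs]
  refine norm_integral_le_of_norm_le (integrable_bump.mul_const _) (.of_forall fun y => ?_)
  rw [norm_mul, Real.norm_of_nonneg (bump_nonneg y)]
  by_cases hy : y ∈ closedBall (0 : E3) 1
  · exact mul_le_mul_of_nonneg_left (abs_cubicField_le (hM y (mem_closedBall_zero_iff.1 hy)) hx
      (mem_closedBall_zero_iff.1 hy) j l) (bump_nonneg y)
  · simp [bump_eq_zero hy]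

theorem exists_avgField_le (hσ : σ ≤ 0)
    (hC : ∀ z i j, |h z i j| ≤ C * (1 + ‖z‖) ^ σ) (j l : Fin 3) :
    ∃ K, ∀ t x, 0 ≤ t → 2 ≤ ‖x‖ → |avgField h t x j l| ≤ K * (‖x‖ ^ 3 * (1 + t * ‖x‖) ^ σ) := by
  have hC0 : 0 ≤ C := by simpa using (abs_nonneg _).trans (hC 0 0 0)
  refine ⟨144 * (C * (1 / 2) ^ σ), fun t x ht hx => ?_⟩
  refine (abs_avgField_le (M := C * ((1 / 2) ^ σ * (1 + t * ‖x‖) ^ σ))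
    (fun y hy i j => (hC _ i j).trans (mul_le_mul_of_nonneg_left ?_ hC0)) hx j l).trans_eq (by ring)
  have h0 : 0 ≤ t * ‖x‖ := by positivity
  rw [← Real.mul_rpow (by norm_num) (by linarith)]
  refine Real.rpow_le_rpow_of_nonpos (by linarith) ?_ hσ
  linarith [norm_dil_ge ht hx hy]

/-- With base point 0 the dilated point has norm exactly t‖x‖, so no sign of σ is needed, in
contrast to `exists_avgField_le`. -/
theorem exists_cubicField_le (hC : ∀ z i j, |h z i j| ≤ C * (1 + ‖z‖) ^ σ) (j l : Fin 3) :
    ∃ K, ∀ t x, 0 ≤ t → 2 ≤ ‖x‖ →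
      |cubicField h t 0 x j l| ≤ K * (‖x‖ ^ 3 * (1 + t * ‖x‖) ^ σ) := by
  refine ⟨144 * C, fun t x ht hx => ?_⟩
  refine (abs_cubicField_le (M := C * (1 + t * ‖x‖) ^ σ) (fun i j => ?_) hx (by simp) j
    l).trans_eq (by ring)
  have := hC (dil t x 0) i j
  rwa [congrArg norm (dil_zero t x), norm_smul, Real.norm_of_nonneg ht] at this

end Growth

/-! ### One-dimensional integrals -/

theorem integrableOn_rpow_mul {p : ℝ} (hp : 0 ≤ p) (σ : ℝ) {r : ℝ} (hr : 0 ≤ r) :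
    IntegrableOn (fun t : ℝ => t ^ p * (1 + t * r) ^ σ) (Ioc 0 1) := by
  refine (ContinuousOn.integrableOn_Icc ?_).mono_set Ioc_subset_Icc_self
  refine (Real.continuous_rpow_const hp).continuousOn.mul
    (ContinuousOn.rpow_const (by fun_prop) fun t ht => .inl ?_)
  have := mul_nonneg ht.1 hr
  positivity

/-- The part t ≤ 1 is measured by `L`. For t > 1, 1 + tr is comparable to tr, which leaves r^σ times
a convergent integral; `hB` absorbs it into `L`. -/
theorem exists_integral_weight_le {E : ℝ → E3 → ℝ} {W : ℝ → ℝ} {L : ℝ → ℝ} {σ p ν K D B : ℝ}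
    (hp : 0 ≤ p) (hν : ν + σ < -1)
    (hE : ∀ t x, 0 ≤ t → 2 ≤ ‖x‖ → |E t x| ≤ K * (‖x‖ ^ 3 * (1 + t * ‖x‖) ^ σ))
    (hW0 : ∀ t, t ≤ 0 → W t = 0) (hW1 : ∀ t, 0 < t → t ≤ 1 → |W t| ≤ D * t ^ p)
    (hW2 : ∀ t, 1 < t → |W t| ≤ D * t ^ ν)
    (hL : ∀ r, 2 ≤ r → ∫ t in Ioc (0 : ℝ) 1, t ^ p * (1 + t * r) ^ σ ≤ L r * r ^ σ)
    (hB : ∀ r, 2 ≤ r → 1 ≤ B * L r) :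
    ∃ M, ∀ x : E3, 2 ≤ ‖x‖ → |∫ t, W t * E t x| ≤ M * (‖x‖ ^ (σ + 3) * L ‖x‖) := by
  have hD : 0 ≤ D := by simpa using (abs_nonneg _).trans (hW1 1 one_pos le_rfl)
  have hK : 0 ≤ K := by
    have h1 : ‖EuclideanSpace.single (0 : Fin 3) (2 : ℝ)‖ = 2 := by simp
    have := (abs_nonneg _).trans (hE 0 (EuclideanSpace.single 0 2) le_rfl h1.ge)
    rw [h1] at this
    norm_num at this
    exact this
  have hJ := integrableOn_Ioi_rpow_of_lt hν one_pos
  set J := ∫ t in Ioi (1 : ℝ), t ^ (ν + σ) with hJdef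
  have hJ0 : 0 ≤ J := setIntegral_nonneg measurableSet_Ioi fun t ht =>
    Real.rpow_nonneg (zero_le_one.trans (le_of_lt ht)) _
  refine ⟨D * K * (1 + 2 ^ |σ| * J * B), fun x hx => ?_⟩
  set r := ‖x‖ with hr
  have hr0 : 0 < r := by linarith
  have hA := (integrable_indicator_iff measurableSet_Ioc).2 (integrableOn_rpow_mul hp σ hr0.le)
  have hG := (integrable_indicator_iff measurableSet_Ioi).2 hJ
  have hle : |∫ t, W t * E t x| ≤ ∫ t, (D * K * r ^ 3 * (Ioc (0 : ℝ) 1).indicator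
      (fun t : ℝ => t ^ p * (1 + t * r) ^ σ) t + D * K * r ^ 3 * (2 ^ |σ| * r ^ σ) *
        (Ioi (1 : ℝ)).indicator (fun t : ℝ => t ^ (ν + σ)) t) := by
    rw [← Real.norm_eq_abs]
    refine norm_integral_le_of_norm_le ((hA.const_mul _).add (hG.const_mul _))
      (.of_forall fun t => ?_)
    rw [norm_mul, Real.norm_eq_abs, Real.norm_eq_abs]
    rcases le_or_gt t 0 with ht | ht
    · have h1 : t ∉ Ioc (0 : ℝ) 1 := fun h => not_lt.2 ht h.1
      have h2 : t ∉ Ioi (1 : ℝ) := fun h => not_lt.2 (ht.trans zero_le_one) h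
      simp [hW0 t ht, indicator_of_notMem h1, indicator_of_notMem h2]
    · have hEt := hE t x ht.le hx
      rw [← hr] at hEt
      rcases le_or_gt t 1 with ht1 | ht1
      · rw [indicator_of_mem (mem_Ioc.2 ⟨ht, ht1⟩), indicator_of_notMem (notMem_Ioi.2 ht1), mul_zero,
          add_zero]
        refine (mul_le_mul (hW1 t ht ht1) hEt (abs_nonneg _) ?_).trans_eq (by ring)
        positivity
      · have h2 : t ∉ Ioc (0 : ℝ) 1 := fun h => not_lt.2 h.2 ht1
        rw [indicator_of_notMem h2, indicator_of_mem (mem_Ioi.2 ht1), mul_zero, zero_add]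
        have htr : 1 ≤ t * r := by nlinarith
        have h3 : (1 + t * r) ^ σ ≤ 2 ^ |σ| * (t * r) ^ σ := by
          rcases le_total 0 σ with hs | hs
          · rw [abs_of_nonneg hs, ← Real.mul_rpow (by norm_num) (by linarith)]
            exact Real.rpow_le_rpow (by linarith) (by linarith) hs
          · refine (Real.rpow_le_rpow_of_nonpos (by linarith) (by linarith) hs).trans
              (le_mul_of_one_le_left (Real.rpow_nonneg (by linarith) _)
                (Real.one_le_rpow (by norm_num) (abs_nonneg σ)))
        rw [Real.mul_rpow ht.le hr0.le] at h3
        have h4 : |E t x| ≤ K * (r ^ 3 * (2 ^ |σ| * (t ^ σ * r ^ σ))) := by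
          refine hEt.trans ?_
          gcongr
        refine (mul_le_mul (hW2 t ht1) h4 (abs_nonneg _) (by positivity)).trans_eq ?_
        rw [Real.rpow_add ht]
        ring
  refine hle.trans ?_
  rw [integral_add (hA.const_mul _) (hG.const_mul _), integral_const_mul, integral_const_mul,
    integral_indicator measurableSet_Ioc, integral_indicator measurableSet_Ioi, ← hJdef,
    Real.rpow_add hr0, show r ^ (3 : ℝ) = r ^ 3 by exact_mod_cast Real.rpow_natCast r 3]
  have h5 := hL r hx
  have h6 := hB r hx
  calc D * K * r ^ 3 * (∫ t in Ioc (0 : ℝ) 1, t ^ p * (1 + t * r) ^ σ)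
        + D * K * r ^ 3 * (2 ^ |σ| * r ^ σ) * J
      ≤ D * K * r ^ 3 * (L r * r ^ σ) + D * K * r ^ 3 * (2 ^ |σ| * r ^ σ) * J * (B * L r) := by
        refine add_le_add (mul_le_mul_of_nonneg_left h5 (by positivity))
          (le_mul_of_one_le_right (by positivity) h6)
    _ = _ := by ring

/-- On (0, 1] the base 1 + tr is compared with tr if σ ≤ 0 and with 2r if σ ≥ 0; `min σ 0` covers
both cases. -/
theorem integral_rpow_mul_le {σ p : ℝ} (hp : 0 ≤ p) (hσ : -1 < p + σ) :
    ∃ A, 1 ≤ A ∧ ∀ r : ℝ, 2 ≤ r →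
      ∫ t in Ioc (0 : ℝ) 1, t ^ p * (1 + t * r) ^ σ ≤ A * r ^ σ := by
  have hs : -1 < p + min σ 0 := by
    rcases le_total σ 0 with h | h
    · rwa [min_eq_left h]
    · rw [min_eq_right h]
      linarith
  have hI : IntegrableOn (fun t : ℝ => t ^ (p + min σ 0)) (Ioc 0 1) :=
    (intervalIntegrable_iff_integrableOn_Ioc_of_le zero_le_one).1
      (intervalIntegral.intervalIntegrable_rpow' hs)
  refine ⟨max 1 (2 ^ |σ| * ∫ t in Ioc (0 : ℝ) 1, t ^ (p + min σ 0)), le_max_left _ _,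
    fun r hr => ?_⟩
  have hr0 : 0 < r := by linarith
  calc ∫ t in Ioc (0 : ℝ) 1, t ^ p * (1 + t * r) ^ σ
      ≤ ∫ t in Ioc (0 : ℝ) 1, 2 ^ |σ| * r ^ σ * t ^ (p + min σ 0) := by
        refine setIntegral_mono_on (integrableOn_rpow_mul hp σ hr0.le) (hI.const_mul _)
          measurableSet_Ioc fun t ht => ?_
        have ht0 : 0 ≤ t ^ p := Real.rpow_nonneg ht.1.le _
        have htr : 0 < t * r := mul_pos ht.1 hr0
        rw [Real.rpow_add ht.1]
        have key : (1 + t * r) ^ σ ≤ 2 ^ |σ| * r ^ σ * t ^ min σ 0 := by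
          rcases le_total σ 0 with h | h
          · rw [min_eq_left h, mul_assoc, mul_comm (r ^ σ), ← Real.mul_rpow ht.1.le hr0.le]
            exact (Real.rpow_le_rpow_of_nonpos htr (by linarith) h).trans
              (le_mul_of_one_le_left (Real.rpow_nonneg htr.le _)
                (Real.one_le_rpow (by norm_num) (abs_nonneg σ)))
          · rw [min_eq_right h, abs_of_nonneg h, Real.rpow_zero, mul_one,
              ← Real.mul_rpow (by norm_num) hr0.le]
            refine Real.rpow_le_rpow (by positivity) ?_ h
            nlinarith [ht.2]
        calc t ^ p * (1 + t * r) ^ σ ≤ t ^ p * (2 ^ |σ| * r ^ σ * t ^ min σ 0) := by gcongr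
          _ = _ := by ring
    _ = 2 ^ |σ| * (∫ t in Ioc (0 : ℝ) 1, t ^ (p + min σ 0)) * r ^ σ := by
        rw [integral_const_mul]
        ring
    _ ≤ _ := mul_le_mul_of_nonneg_right (le_max_right _ _) (Real.rpow_nonneg hr0.le _)

/-- Since t^p ≤ r^(-p) (1 + tr)^p, the integrand is at most r^(-p) (1 + tr)⁻¹, whose integral is a
logarithm. -/
theorem integral_rpow_mul_le_log {σ p : ℝ} (hp : 0 ≤ p) (hσ : p + σ = -1) {r : ℝ} (hr : 2 ≤ r) :
    ∫ t in Ioc (0 : ℝ) 1, t ^ p * (1 + t * r) ^ σ ≤ 2 * Real.log r * r ^ σ := by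
  have hr0 : 0 < r := by linarith
  have hpos : ∀ t ∈ Icc (0 : ℝ) 1, 0 < 1 + t * r := fun t ht => by
    have := mul_nonneg ht.1 hr0.le
    positivity
  have hcont : ContinuousOn (fun t : ℝ => (1 + t * r)⁻¹) (Icc 0 1) :=
    ContinuousOn.inv₀ (by fun_prop) fun t ht => (hpos t ht).ne'
  have hI := (hcont.integrableOn_Icc (μ := volume)).mono_set Ioc_subset_Icc_self
  have hlog : ∫ t in Ioc (0 : ℝ) 1, (1 + t * r)⁻¹ = Real.log (1 + r) / r := by
    rw [← intervalIntegral.integral_of_le zero_le_one]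
    have hd : ∀ t ∈ uIcc (0 : ℝ) 1,
        HasDerivAt (fun t => Real.log (1 + t * r) / r) (1 + t * r)⁻¹ t := fun t ht => by
      rw [uIcc_of_le zero_le_one] at ht
      have h1 : HasDerivAt (fun t : ℝ => 1 + t * r) r t := by
        simpa using ((hasDerivAt_id t).mul_const r).const_add 1
      refine ((h1.log (hpos t ht).ne').div_const r).congr_deriv ?_
      field_simp
    rw [intervalIntegral.integral_eq_sub_of_hasDerivAt hd]
    · simp
    · exact (hcont.mono (by rw [uIcc_of_le zero_le_one])).intervalIntegrable
  calc ∫ t in Ioc (0 : ℝ) 1, t ^ p * (1 + t * r) ^ σ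
      ≤ ∫ t in Ioc (0 : ℝ) 1, r ^ (-p) * (1 + t * r)⁻¹ := by
        refine setIntegral_mono_on (integrableOn_rpow_mul hp σ hr0.le) (hI.const_mul _)
          measurableSet_Ioc fun t ht => ?_
        have h0 := hpos t ⟨ht.1.le, ht.2⟩
        have hσ' : σ = -p + -1 := by linarith
        rw [hσ', Real.rpow_add h0, Real.rpow_neg_one, ← mul_assoc]
        refine mul_le_mul_of_nonneg_right ?_ (inv_nonneg.2 h0.le)
        rw [Real.rpow_neg h0.le, Real.rpow_neg hr0.le, ← div_eq_mul_inv,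
          div_le_iff₀ (Real.rpow_pos_of_pos h0 _), inv_mul_eq_div, le_div_iff₀
          (Real.rpow_pos_of_pos hr0 _), ← Real.mul_rpow ht.1.le hr0.le]
        exact Real.rpow_le_rpow (mul_nonneg ht.1.le hr0.le) (by linarith) hp
    _ = Real.log (1 + r) * r ^ σ := by
        rw [integral_const_mul, hlog, show σ = -p - 1 by linarith, Real.rpow_sub_one hr0.ne']
        ring
    _ ≤ _ := by
        refine mul_le_mul_of_nonneg_right ?_ (Real.rpow_nonneg hr0.le _)
        have h1 : 2 * Real.log r = Real.log (r ^ 2) := by simp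
        rw [h1]
        exact Real.log_le_log (by linarith) (by nlinarith)

end TTPotential
end

noncomputable section

namespace TTPotential

open MeasureTheory Metric Set Filter

/-! ### Existence of potentials with controlled growth -/

theorem exists_bound_of_isBigO {h : TensorField} (hc : Continuous h) {σ : ℝ}
    (hO : h =O[cocompact E3] fun x => ‖x‖ ^ σ) :
    ∃ C, ∀ z i j, |h z i j| ≤ C * (1 + ‖z‖) ^ σ := by
  obtain ⟨c, hc0, hcb⟩ := hO.exists_pos
  obtain ⟨K, hK, hKs⟩ := mem_cocompact.1 (hcb.bound.and
    (tendsto_norm_cocompact_atTop.eventually_ge_atTop 1))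
  have hpos : ∀ z : E3, 0 < 1 + ‖z‖ := fun z => by positivity
  obtain ⟨B, hB⟩ := hK.exists_bound_of_continuousOn (f := fun z => ‖h z‖ * (1 + ‖z‖) ^ (-σ))
    (hc.norm.mul (Continuous.rpow_const (by fun_prop) fun z => .inl (hpos z).ne')).continuousOn
  refine ⟨max B (c * 2 ^ |σ|), fun z i j => ?_⟩
  have h1 : |h z i j| ≤ ‖h z‖ := (norm_le_pi_norm (h z i) j).trans (norm_le_pi_norm (h z) i)
  have h2 := Real.rpow_pos_of_pos (hpos z) σ
  refine h1.trans ?_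
  by_cases hz : z ∈ K
  · have h3 := (le_abs_self _).trans (hB z hz)
    rw [Real.rpow_neg (hpos z).le, ← div_eq_mul_inv, div_le_iff₀ h2] at h3
    exact h3.trans (mul_le_mul_of_nonneg_right (le_max_left _ _) h2.le)
  · obtain ⟨h3, h4⟩ := hKs hz
    have hz0 : 0 < ‖z‖ := by linarith
    rw [Real.norm_of_nonneg (Real.rpow_nonneg hz0.le _)] at h3
    have h5 : ‖z‖ ^ σ ≤ 2 ^ |σ| * (1 + ‖z‖) ^ σ := by
      rcases le_total 0 σ with hs | hs
      · exact (Real.rpow_le_rpow hz0.le (by linarith) hs).trans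
          (le_mul_of_one_le_left h2.le (Real.one_le_rpow one_le_two (abs_nonneg σ)))
      · have h6 : (2 * ‖z‖) ^ σ ≤ (1 + ‖z‖) ^ σ :=
          Real.rpow_le_rpow_of_nonpos (hpos z) (by linarith) hs
        calc ‖z‖ ^ σ = 2 ^ |σ| * (2 * ‖z‖) ^ σ := by
              rw [abs_of_nonpos hs, Real.mul_rpow zero_le_two hz0.le, ← mul_assoc,
                ← Real.rpow_add zero_lt_two, neg_add_cancel, Real.rpow_zero, one_mul]
          _ ≤ _ := by gcongr
    calc ‖h z‖ ≤ c * ‖z‖ ^ σ := h3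
      _ ≤ c * (2 ^ |σ| * (1 + ‖z‖) ^ σ) := by gcongr
      _ = c * 2 ^ |σ| * (1 + ‖z‖) ^ σ := by ring
      _ ≤ _ := mul_le_mul_of_nonneg_right (le_max_right _ _) h2.le

/-- The components of `u` are `O(F(‖x‖))`, uniformly for `‖x‖ ≥ 2`. -/
def HasGrowth (F : ℝ → ℝ) (u : TensorField) : Prop :=
  ∀ j l, ∃ M, ∀ x, 2 ≤ ‖x‖ → |u x j l| ≤ M * F ‖x‖

theorem HasGrowth.isBigO {F : ℝ → ℝ} {u : TensorField} (hu : HasGrowth F u) :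
    u =O[cocompact E3] fun x => F ‖x‖ := by
  refine Asymptotics.isBigO_pi.2 fun j => Asymptotics.isBigO_pi.2 fun l => ?_
  obtain ⟨M, hM⟩ := hu j l
  refine Asymptotics.IsBigO.of_bound |M| ?_
  filter_upwards [tendsto_norm_cocompact_atTop.eventually_ge_atTop 2] with x hx
  rw [Real.norm_eq_abs, Real.norm_eq_abs, ← abs_mul]
  exact (hM x hx).trans (le_abs_self _)

/-- The function `L` bounds the integral of `t ^ p (1 + t r) ^ σ` over the unit interval, in units
of `r ^ σ`. -/
def BoundsUnitIntegral (p σ : ℝ) (L : ℝ → ℝ) : Prop :=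
  ∀ r, 2 ≤ r → 1 ≤ L r ∧ ∫ t in Ioc (0 : ℝ) 1, t ^ p * (1 + t * r) ^ σ ≤ L r * r ^ σ

theorem exists_boundsUnitIntegral_const {σ p : ℝ} (hp : 0 ≤ p) (hσ : -1 < p + σ) :
    ∃ A, BoundsUnitIntegral p σ fun _ => A := by
  obtain ⟨A, hA, h⟩ := integral_rpow_mul_le hp hσ
  exact ⟨A, fun r hr => ⟨hA, h r hr⟩⟩

theorem boundsUnitIntegral_log {σ p : ℝ} (hp : 0 ≤ p) (hσ : p + σ = -1) :
    BoundsUnitIntegral p σ fun r => 2 * Real.log r := fun r hr => by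
  refine ⟨?_, integral_rpow_mul_le_log hp hσ hr⟩
  have := Real.log_le_log two_pos hr
  linarith [Real.log_two_gt_d9]

section Existence

variable {h : TensorField} {σ C p : ℝ} {L : ℝ → ℝ}

theorem hasGrowth_explicitPotential (hh : IsTT h)
    (hC : ∀ z i j, |h z i j| ≤ C * (1 + ‖z‖) ^ σ) (hL : BoundsUnitIntegral 1 σ L) :
    HasGrowth (fun r => r ^ (σ + 3) * L r) (explicitPotential h) := by
  intro j l
  obtain ⟨K, hK⟩ := exists_cubicField_le hC j l
  simp only [explicitPotential_eq hh.contDiff]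
  have hw : ∀ t, 0 < t → t ≤ 1 → |unitWeight t| ≤ 1 * t ^ (1 : ℝ) := fun t h0 h1 => by
    rw [unitWeight, indicator_of_mem (mem_Icc.2 ⟨h0.le, h1⟩), Real.rpow_one, one_mul, abs_of_nonneg
      (by positivity)]
    exact mul_le_of_le_one_right h0.le (pow_le_one₀ (by linarith) (by linarith))
  -- The weight vanishes for t > 1, so any ν with ν + σ < -1 serves.
  refine exists_integral_weight_le (E := fun t x => cubicField h t 0 x j l) (ν := -σ - 2) (B := 1)
    zero_le_one (by linarith) hK (fun t ht => ?_) hw (fun t ht => ?_) (fun r hr => (hL r hr).2)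
    fun r hr => by linarith [(hL r hr).1]
  · rcases ht.lt_or_eq with h0 | rfl
    · exact unitWeight_eq_zero fun h' => not_lt.2 h'.1 h0
    · simp [unitWeight]
  · rw [unitWeight_eq_zero fun h' => not_lt.2 h'.2 ht, abs_zero]
    exact mul_nonneg zero_le_one (Real.rpow_nonneg (by linarith) _)

theorem hasGrowth_modifiedPotential {a b c : ℝ} {n : ℕ} {D : ℝ} (hσ : σ ≤ 0)
    (hC : ∀ z i j, |h z i j| ≤ C * (1 + ‖z‖) ^ σ) (hn : n + σ < -1) (hq : QuadGrowth a b c n)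
    (hp : 0 ≤ p) (hw : ∀ t : ℝ, 0 < t → t ≤ 1 →
      |t * (1 - t) ^ 2 - (a + b * t + c * t ^ 2) * t| ≤ D * t ^ p)
    (hL : BoundsUnitIntegral p σ L) :
    HasGrowth (fun r => r ^ (σ + 3) * L r) (modifiedPotential h a b c) := by
  intro j l
  obtain ⟨K, hK⟩ := exists_avgField_le hσ hC j l
  obtain ⟨A, hA⟩ := hq
  refine exists_integral_weight_le (E := fun t x => avgField h t x j l) (D := max D A) (ν := n)
    (B := 1) hp hn hK (fun t ht => ?_) (fun t h0 h1 => ?_) (fun t ht => ?_)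
    (fun r hr => (hL r hr).2) fun r hr => by linarith [(hL r hr).1]
  · rw [modifiedWeight, indicator_of_notMem (notMem_Ioi.2 ht), sub_zero]
    rcases ht.lt_or_eq with h0 | rfl
    · exact unitWeight_eq_zero fun h' => not_lt.2 h'.1 h0
    · simp [unitWeight]
  · rw [modifiedWeight, unitWeight, indicator_of_mem (mem_Icc.2 ⟨h0.le, h1⟩),
      indicator_of_mem (mem_Ioi.2 h0)]
    exact (hw t h0 h1).trans
      (mul_le_mul_of_nonneg_right (le_max_left _ _) (Real.rpow_nonneg h0.le _))
  · rw [modifiedWeight, unitWeight_eq_zero fun h' => not_lt.2 h'.2 ht,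
      indicator_of_mem (mem_Ioi.2 (zero_lt_one.trans ht)), zero_sub, abs_neg, Real.rpow_natCast]
    exact (hA t ht.le).1.trans
      (mul_le_mul_of_nonneg_right (le_max_right _ _) (by positivity))

theorem quadGrowth_one : QuadGrowth 1 0 0 1 :=
  ⟨1, fun t ht => by
    have : |t| = t := abs_of_nonneg (by linarith)
    simp [this]
    linarith⟩

theorem quadGrowth_two : QuadGrowth 1 (-2) 0 2 := by
  refine ⟨2, fun t ht => ⟨abs_le.2 ⟨?_, ?_⟩, abs_le.2 ⟨?_, ?_⟩, abs_le.2 ⟨?_, ?_⟩⟩⟩ <;>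
  nlinarith

theorem quadGrowth_three : QuadGrowth 1 (-2) 1 3 := by
  have h3 : ∀ t : ℝ, 1 ≤ t → 0 ≤ t ^ 3 ∧ t ≤ t ^ 2 ∧ t ^ 2 ≤ t ^ 3 := fun t ht =>
    ⟨by positivity, by nlinarith, by nlinarith [sq_nonneg t]⟩
  refine ⟨2, fun t ht => ?_⟩
  obtain ⟨h0, h1, h2⟩ := h3 t ht
  refine ⟨abs_le.2 ⟨?_, ?_⟩, abs_le.2 ⟨?_, ?_⟩, abs_le.2 ⟨?_, ?_⟩⟩ <;>
  ring_nf <;> linarith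

/-- Potentials modified by a polynomial of degree at most three. -/
theorem IsTT.modifiedPotential_of_bound (hh : IsTT h) (hσ : σ ≤ 0)
    (hC : ∀ z i j, |h z i j| ≤ C * (1 + ‖z‖) ^ σ) {a b c : ℝ} {n : ℕ} (hn3 : n ≤ 3)
    (hn : n + σ < -1) (hq : QuadGrowth a b c n) :
    IsSymTraceless (TTPotential.modifiedPotential h a b c) ∧
      P (TTPotential.modifiedPotential h a b c) = h := by
  have hn3' : (n : ℝ) ≤ 3 := by exact_mod_cast hn3
  have hC0 : 0 ≤ C := by simpa using (abs_nonneg _).trans (hC 0 0 0)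
  have hm0 : max σ (-(9 / 2)) ≤ 0 := max_le hσ (by norm_num)
  -- The averages need an exponent above -5, and n ≤ 3 needs one below -4. Faster decay is therefore
  -- weakened to -9/2, strictly between the two.
  refine hh.modifiedPotential (σ := max σ (-(9 / 2))) (C := C) (lt_max_of_lt_right (by norm_num))
    (fun z i j hz => (hC z i j).trans (mul_le_mul_of_nonneg_left ?_ hC0)) ?_ hq
  · have hz0 := norm_pos_iff.2 hz
    exact (Real.rpow_le_rpow_of_exponent_le (by linarith) (le_max_left _ _)).trans
      (Real.rpow_le_rpow_of_nonpos hz0 (by linarith) hm0)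
  · rcases max_choice σ (-(9 / 2)) with e | e <;> rw [e] <;> linarith

/-- Away from the exponents `-4`, `-3`, `-2`, with `p` depending on the exponent, a potential has
the growth permitted by `BoundsUnitIntegral`. -/
theorem IsTT.exists_potential (hh : IsTT h) (hO : h =O[cocompact E3] fun x => ‖x‖ ^ σ) :
    ∃ p, 0 ≤ p ∧ (σ ∉ ({-4, -3, -2} : Set ℝ) → -1 < p + σ) ∧
      (σ ∈ ({-4, -3, -2} : Set ℝ) → p + σ = -1) ∧
      ∀ L, BoundsUnitIntegral p σ L → ∃ u : TensorField, IsSymTraceless u ∧ P u = h ∧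
        HasGrowth (fun r => r ^ (σ + 3) * L r) u := by
  obtain ⟨C, hC⟩ := exists_bound_of_isBigO hh.smooth.continuous hO
  simp only [mem_insert_iff, mem_singleton_iff, not_or]
  rcases le_or_gt (-2) σ with h2 | h2
  · refine ⟨1, zero_le_one, fun hs => ?_, fun hs => ?_, fun L hL => ⟨_, hh.explicitPotential.1,
      hh.explicitPotential.2, hasGrowth_explicitPotential hh hC hL⟩⟩
    · linarith [lt_of_le_of_ne h2 (Ne.symm hs.2.2)]
    · rcases hs with rfl | rfl | rfl <;> linarith
  have hσ : σ ≤ 0 := by linarith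
  rcases le_or_gt (-3) σ with h3 | h3
  · have hn : (1 : ℕ) + σ < -1 := by push_cast; linarith
    obtain ⟨hu, hP⟩ := hh.modifiedPotential_of_bound hσ hC (by norm_num) hn quadGrowth_one
    -- The remaining weight on (0, 1] is -2t² + t³, of size at most 3t².
    refine ⟨2, zero_le_two, fun hs => ?_, fun hs => ?_, fun L hL => ⟨_, hu, hP,
      hasGrowth_modifiedPotential (D := 3) hσ hC hn quadGrowth_one zero_le_two
        (fun t h0 h1 => ?_) hL⟩⟩
    · linarith [lt_of_le_of_ne h3 (Ne.symm hs.2.1)]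
    · rcases hs with rfl | rfl | rfl <;> linarith
    · rw [Real.rpow_two]
      exact abs_le.2 ⟨by nlinarith [pow_pos h0 2, pow_pos h0 3],
        by nlinarith [pow_pos h0 2, pow_pos h0 3]⟩
  rcases le_or_gt (-4) σ with h4 | h4
  · have hn : (2 : ℕ) + σ < -1 := by push_cast; linarith
    obtain ⟨hu, hP⟩ := hh.modifiedPotential_of_bound hσ hC (by norm_num) hn quadGrowth_two
    -- The remaining weight on (0, 1] is exactly t³.
    refine ⟨3, zero_le_three, fun hs => ?_, fun hs => ?_, fun L hL => ⟨_, hu, hP,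
      hasGrowth_modifiedPotential (D := 1) hσ hC hn quadGrowth_two zero_le_three
        (fun t h0 h1 => ?_) hL⟩⟩
    · linarith [lt_of_le_of_ne h4 (Ne.symm hs.1)]
    · rcases hs with rfl | rfl | rfl <;> linarith
    · rw [show t ^ (3 : ℝ) = t ^ 3 by exact_mod_cast Real.rpow_natCast t 3,
        ← abs_of_pos (pow_pos h0 3)]
      exact le_of_eq (by rw [one_mul]; congr 1; ring)
  · have hn : (3 : ℕ) + σ < -1 := by push_cast; linarith
    obtain ⟨hu, hP⟩ := hh.modifiedPotential_of_bound hσ hC le_rfl hn quadGrowth_three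
    -- Nothing remains of the weight on (0, 1], so p is arbitrary; p = -σ gives p + σ = 0 > -1.
    refine ⟨-σ, by linarith, fun hs => by linarith, fun hs => ?_, fun L hL => ⟨_, hu, hP,
      hasGrowth_modifiedPotential (D := 0) hσ hC hn quadGrowth_three (by linarith)
        (fun t h0 h1 => ?_) hL⟩⟩
    · rcases hs with rfl | rfl | rfl <;> linarith
    · rw [zero_mul]
      exact le_of_eq (abs_eq_zero.2 (by ring))

/-- Away from the exceptional exponents, potentials gain three powers. -/
theorem IsTT.exists_potential_isBigO (hh : IsTT h) (hO : h =O[cocompact E3] fun x => ‖x‖ ^ σ)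
    (hσ : σ ∉ ({-4, -3, -2} : Set ℝ)) :
    ∃ u : TensorField, IsSymTraceless u ∧ P u = h ∧
      u =O[cocompact E3] fun x => ‖x‖ ^ (σ + 3) := by
  obtain ⟨p, hp, h1, -, h2⟩ := hh.exists_potential hO
  obtain ⟨A, hA⟩ := exists_boundsUnitIntegral_const hp (h1 hσ)
  obtain ⟨u, hu, hP, hg⟩ := h2 _ hA
  refine ⟨u, hu, hP, hg.isBigO.trans ?_⟩
  simp only [mul_comm _ A]
  exact Asymptotics.isBigO_const_mul_self _ _ _

/-- For the exceptional exponents, there is an additional logarithm. -/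
theorem IsTT.exists_potential_isBigO_log (hh : IsTT h)
    (hO : h =O[cocompact E3] fun x => ‖x‖ ^ σ) (hσ : σ ∈ ({-4, -3, -2} : Set ℝ)) :
    ∃ u : TensorField, IsSymTraceless u ∧ P u = h ∧
      u =O[cocompact E3] fun x => ‖x‖ ^ (σ + 3) * Real.log ‖x‖ := by
  obtain ⟨p, hp, -, h1, h2⟩ := hh.exists_potential hO
  obtain ⟨u, hu, hP, hg⟩ := h2 _ (boundsUnitIntegral_log hp (h1 hσ))
  refine ⟨u, hu, hP, hg.isBigO.trans ?_⟩
  simp only [mul_left_comm _ (2 : ℝ)]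
  exact Asymptotics.isBigO_const_mul_self _ _ _

/-- Compactly supported TT tensors have compactly supported potentials. -/
theorem IsTT.exists_potential_hasCompactSupport (hh : IsTT h) (hsupp : HasCompactSupport h) :
    ∃ u : TensorField, IsSymTraceless u ∧ P u = h ∧ HasCompactSupport u := by
  obtain ⟨R, hR⟩ := hsupp.isCompact.isBounded.subset_closedBall (0 : E3)
  have hzero : ∀ z, R < ‖z‖ → h z = 0 := fun z hz => by
    by_contra h0
    exact not_le.2 hz (mem_closedBall_zero_iff.1 (hR (subset_tsupport _ h0)))
  -- Any exponent below -4 allows the full quadratic (1 - t)².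
  have hO : h =O[cocompact E3] fun x => ‖x‖ ^ (-5 : ℝ) := by
    refine Asymptotics.IsBigO.of_bound 1 ?_
    filter_upwards [tendsto_norm_cocompact_atTop.eventually_gt_atTop R] with x hx
    rw [hzero x hx, norm_zero, one_mul]
    exact norm_nonneg _
  obtain ⟨C, hC⟩ := exists_bound_of_isBigO hh.smooth.continuous hO
  obtain ⟨hu, hP⟩ := hh.modifiedPotential_of_bound (by norm_num) hC le_rfl (by norm_num)
    quadGrowth_three
  -- For t ≥ 1, `norm_dil_ge` puts the dilated point at norm at least (1 + ‖x‖)/2 - 1, which exceeds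
  -- |R| once ‖x‖ > 2|R| + 4.
  refine ⟨_, hu, hP, HasCompactSupport.intro (isCompact_closedBall 0 (2 * |R| + 4))
    fun x hx => ?_⟩
  rw [mem_closedBall_zero_iff, not_le] at hx
  funext j l
  rw [TTPotential.modifiedPotential, Pi.zero_apply, Pi.zero_apply]
  refine integral_eq_zero_of_ae (.of_forall fun t => mul_eq_zero.2 ?_)
  have hR0 := abs_nonneg R
  rcases le_or_gt t 0 with ht | ht
  · left
    rw [modifiedWeight, indicator_of_notMem (notMem_Ioi.2 ht), sub_zero, unitWeight]
    by_cases h0 : t ∈ Icc (0 : ℝ) 1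
    · rw [indicator_of_mem h0, le_antisymm ht h0.1, zero_mul]
    · exact indicator_of_notMem h0 _
  -- On (0, 1] the two weights cancel; for t > 1 the averaged field is zero, as h vanishes at all
  -- the points sampled.
  rcases le_or_gt t 1 with h1 | h1
  · left
    rw [modifiedWeight, indicator_of_mem (mem_Ioi.2 ht), unitWeight,
      indicator_of_mem (mem_Icc.2 ⟨ht.le, h1⟩)]
    ring
  · right
    have h2 := abs_avgField_le (M := 0) (h := h) (t := t) (x := x) (fun y hy i j => ?_)
      (by linarith) j l
    · rw [mul_zero, mul_zero] at h2
      exact abs_nonpos_iff.1 h2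
    · have h3 := norm_dil_ge ht.le (by linarith : 2 ≤ ‖x‖) hy
      have h4 : ‖x‖ ≤ t * ‖x‖ := le_mul_of_one_le_left (norm_nonneg _) h1.le
      rw [hzero _ (by linarith [le_abs_self R])]
      simp

end Existence

end TTPotential
end

theorem mainTheorem4 :
    -- every TT tensor is `P` of its explicit potential
    (∀ h : TTPotential.TensorField, TTPotential.IsTT h →
      TTPotential.IsSymTraceless (TTPotential.explicitPotential h) ∧
        TTPotential.P (TTPotential.explicitPotential h) = h) ∧
    -- conversely, `P u` is TT for every symmetric traceless `u`
    (∀ u : TTPotential.TensorField, TTPotential.IsSymTraceless u →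
      TTPotential.IsTT (TTPotential.P u)) ∧
    -- asymptotic behaviour, non-exceptional exponents
    (∀ (h : TTPotential.TensorField) (σ : ℝ), TTPotential.IsTT h →
      h =O[Filter.cocompact TTPotential.E3] (fun x => ‖x‖ ^ σ) →
      σ ∉ ({-4, -3, -2} : Set ℝ) →
      ∃ u : TTPotential.TensorField, TTPotential.IsSymTraceless u ∧ TTPotential.P u = h ∧
        u =O[Filter.cocompact TTPotential.E3] (fun x => ‖x‖ ^ (σ + 3))) ∧
    -- asymptotic behaviour, exceptional exponents
    (∀ (h : TTPotential.TensorField) (σ : ℝ), TTPotential.IsTT h →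
      h =O[Filter.cocompact TTPotential.E3] (fun x => ‖x‖ ^ σ) →
      σ ∈ ({-4, -3, -2} : Set ℝ) →
      ∃ u : TTPotential.TensorField, TTPotential.IsSymTraceless u ∧ TTPotential.P u = h ∧
        u =O[Filter.cocompact TTPotential.E3]
          (fun x => ‖x‖ ^ (σ + 3) * Real.log ‖x‖)) ∧
    -- compact support
    (∀ h : TTPotential.TensorField, TTPotential.IsTT h → HasCompactSupport h →
      ∃ u : TTPotential.TensorField, TTPotential.IsSymTraceless u ∧ TTPotential.P u = h ∧
        HasCompactSupport u) := by
  exact ⟨fun _ hh => hh.explicitPotential, fun _ hu => hu.isTT_P,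
    fun _ _ hh hO hσ => hh.exists_potential_isBigO hO hσ,
    fun _ _ hh hO hσ => hh.exists_potential_isBigO_log hO hσ,
    fun _ hh hs => hh.exists_potential_hasCompactSupport hs⟩
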